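/- For $M\ge 1$ write $[M]=\{0,1,\dots,M-1\}$. For $X\subseteq[M]^n$ (the promise) and $f:X\to\{0,1\}$, let $R(f)$ be the least $q$ such that some randomized algorithm (a probability distribution over deterministic decision trees querying entries of $x$) making at most $q$ queries outputs $f(x)$ with error probability less than $1/3$ for every $x\in X$. Let $Q(f)$ be the least $q$ such that some quantum algorithm making $q$ queries (input-independent unitaries on a finite-dimensional space, interleaved with $q$ applications of the query operator $|i,b,w\rangle\mapsto|i,b+x_i \bmod M,w\rangle$, followed by a measurement in the computational basis) outputs $f(x)$ with error probability less than $1/3$ for every $x\in X$. Call $X\subseteq[M]^n$ symmetric if $(x_{\sigma(1)},\dots,x_{\sigma(n)})\in X$ for all $x\in X$ and $\sigma\in S_n$. **Theorem.** For every integer $M\ge 2$ there is a constant $c>0$, depending only on $M$, such that for every $n\ge 0$, every symmetric $X\subseteq[M]^n$ and every function $f:X\to\{0,1\}$ (not necessarily symmetric), $$Q(f)\ \ge\ c\,R(f)^{1/(12(M-1))}.$$ In particular, for $M=2$ there is an absolute constant $c>0$ such that $Q(f)\ge c\,R(f)^{1/12}$ for every $n$, every symmetric $X\subseteq\{0,1\}^n$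 and every $f:X\to\{0,1\}$. -/

import Mathlib

namespace QueryComplexity

/-! ### Randomized query algorithms -/

/-- Deterministic query algorithms (decision trees) on inputs `x ∈ [M]^n`: a leaf outputs a bit,
an inner node queries an index `i` and continues according to the answer `x i`. -/
inductive DecisionTree (n M : ℕ) : Type
  | leaf (b : Bool) : DecisionTree n M
  | query (i : Fin n) (next : Fin M → DecisionTree n M) : DecisionTree n M

namespace DecisionTree

/-- The output on input `x`. -/
def eval {n M : ℕ} : DecisionTree n M → (Fin n → Fin M) → Bool
  | leaf b, _ => b
  | query i next, x => eval (next (x i)) x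

/-- The worst-case number of queries. -/
def depth {n M : ℕ} : DecisionTree n M → ℕ
  | leaf _ => 0
  | query _ next => 1 + Finset.univ.sup fun a => depth (next a)

end DecisionTree

/-- `f : X → {0,1}` can be computed by a randomized algorithm (a probability distribution over
decision trees) that never makes more than `q` queries and errs with probability less than `1/3`
on every input of the promise `X`. -/
def RandomizedComputable {n M : ℕ} {X : Set (Fin n → Fin M)} (f : X → Bool) (q : ℕ) : Prop :=
  ∃ μ : PMF (DecisionTree n M),
    (∀ T ∈ μ.support, T.depth ≤ q) ∧
    ∀ x : X, (μ.map fun T => T.eval x.1) (!f x) < 1 / 3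

/-- Bounded-error randomized query complexity `R(f)`; for nonempty alphabet the set is nonempty, as
`n` queries always suffice. -/
noncomputable def R {n M : ℕ} {X : Set (Fin n → Fin M)} (f : X → Bool) : ℕ :=
  sInf {q | RandomizedComputable f q}

/-! ### Quantum query algorithms -/

/-- Computational basis states `|i, b, w⟩`: query register `i`, answer register `b`, workspace `w`.
The value `none` of the query register stands for "no query". -/
abbrev Basis (n M : ℕ) (W : Type) : Type := Option (Fin n) × Fin M × W

/-- The query operator `|i, b, w⟩ ↦ |i, b + x_i mod M, w⟩` (and `|none, b, w⟩ ↦ |none, b, w⟩`),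
acting on amplitude vectors. -/
def oracle {n M : ℕ} {W : Type} (x : Fin n → Fin M) (ψ : Basis n M W → ℂ) : Basis n M W → ℂ
  | (some i, b, w) => ψ (some i, b - x i, w)
  | (none, b, w) => ψ (none, b, w)

/-- A quantum query algorithm: a finite-dimensional workspace, an initial basis state, the
input-independent unitaries `U 0, U 1, U 2, …` applied between the queries, and the output bit read
off from the final measurement in the computational basis. When it is run with `q` queries, only
`U 0, …, U q` are used. -/
structure QuantumAlgorithm (n M : ℕ) where
  W : Type
  [fintypeW : Fintype W]
  [decEqW : DecidableEq W]
  init : Basis n M W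
  U : ℕ → Matrix.unitaryGroup (Basis n M W) ℂ
  out : Basis n M W → Bool

namespace QuantumAlgorithm

attribute [instance] fintypeW decEqW

/-- The state `U_q O_x U_{q-1} ⋯ O_x U_0 |init⟩` after `q` queries to `x`. -/
noncomputable def state {n M : ℕ} (A : QuantumAlgorithm n M) (x : Fin n → Fin M) :
    ℕ → Basis n M A.W → ℂ
  | 0 => (A.U 0).1.mulVec (Pi.single A.init 1)
  | q + 1 => (A.U (q + 1)).1.mulVec (oracle x (A.state x q))

/-- The probability that the output is `b` when the state is measured after `q` queries to `x`. -/
noncomputable def prob {n M : ℕ} (A : QuantumAlgorithm n M) (q : ℕ) (x : Fin n → Fin M)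
    (b : Bool) : ℝ :=
  ∑ s with A.out s = b, ‖A.state x q s‖ ^ 2

end QuantumAlgorithm

/-- `f : X → {0,1}` can be computed by a quantum algorithm that makes `q` queries and errs with
probability less than `1/3` on every input of the promise `X`. -/
def QuantumComputable {n M : ℕ} {X : Set (Fin n → Fin M)} (f : X → Bool) (q : ℕ) : Prop :=
  ∃ A : QuantumAlgorithm n M, ∀ x : X, A.prob q x.1 (!f x) < 1 / 3

/-- Bounded-error quantum query complexity `Q(f)`; for nonempty alphabet the set is nonempty, as
`n` queries always suffice. -/
noncomputable def Q {n M : ℕ} {X : Set (Fin n → Fin M)} (f : X → Bool) : ℕ :=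
  sInf {q | QuantumComputable f q}

/-- The promise `X ⊆ [M]^n` is invariant under permuting the entries of its elements. -/
def IsSymmetric {n M : ℕ} (X : Set (Fin n → Fin M)) : Prop :=
  ∀ x ∈ X, ∀ σ : Equiv.Perm (Fin n), (fun i => x (σ i)) ∈ X

end QueryComplexity

/-!
By the hybrid argument, the acceptance probability `F` of a `q`-query quantum algorithm changes
between `z` and `y` by at most the root of the weight of the indices where `z` and `y` differ, for a
weight of total mass `16 q²` that depends on `z` only. Hence a set of inputs on which `F` stays away
from `1/2` has small block sensitivity, and would have short certificates if it were closed under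
changing single entries.

The promise is not closed under such changes, but it is symmetric. Sampling determines the number
of occurrences of every symbol up to a small multiple of `n`. An input whose counts are roughly the
right ones agrees, up to a permutation that moves little of the weight, with an element of the
promise, so `F` is bounded away from `1/2` there as well. For the symbols too rare to be counted
accurately, one allows all inputs containing them no more often than some element of the promise.

This gives a certificate for the value at any candidate input that agrees with the entries read so
far. A certificate for a wrong value has to meet the certificate of the true input in an unread
index: otherwise the two could be combined to a single input with both values. So every wrong guess
reveals a new index of the certificate of the true input, and the majority of the guesses is correct
as soon as there are more than twice as many guesses as the certificate has indices.
-/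

namespace QueryComplexity

/-! ### Amplitude vectors -/

section AmpNorm

variable {ι : Type*} [Fintype ι]

/-- The Euclidean norm of an amplitude vector; the norm that `ι → ℂ` carries in Mathlib is the
supremum norm. -/
noncomputable def ampNorm (ψ : ι → ℂ) : ℝ := ‖WithLp.toLp 2 ψ‖

theorem ampNorm_sq (ψ : ι → ℂ) : ampNorm ψ ^ 2 = ∑ s, ‖ψ s‖ ^ 2 := by
  simp [ampNorm, EuclideanSpace.norm_sq_eq]

theorem ampNorm_nonneg (ψ : ι → ℂ) : 0 ≤ ampNorm ψ := norm_nonneg _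

theorem ampNorm_zero : ampNorm (0 : ι → ℂ) = 0 := by simp [ampNorm]

theorem ampNorm_add_le (ψ φ : ι → ℂ) : ampNorm (ψ + φ) ≤ ampNorm ψ + ampNorm φ := by
  simpa [ampNorm] using norm_add_le (WithLp.toLp 2 ψ) (WithLp.toLp 2 φ)

theorem ampNorm_sub_le (ψ φ : ι → ℂ) : ampNorm (ψ - φ) ≤ ampNorm ψ + ampNorm φ := by
  simpa [ampNorm] using norm_sub_le (WithLp.toLp 2 ψ) (WithLp.toLp 2 φ)

theorem abs_ampNorm_sub_le (ψ φ : ι → ℂ) : |ampNorm ψ - ampNorm φ| ≤ ampNorm (ψ - φ) := by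
  simpa [ampNorm] using abs_norm_sub_norm_le (WithLp.toLp 2 ψ) (WithLp.toLp 2 φ)

theorem ampNorm_single [DecidableEq ι] (s : ι) : ampNorm (Pi.single s (1 : ℂ)) = 1 := by
  simp [ampNorm]

theorem ampNorm_comp_perm (ψ : ι → ℂ) (e : Equiv.Perm ι) : ampNorm (ψ ∘ e) = ampNorm ψ := by
  refine (sq_eq_sq₀ (ampNorm_nonneg _) (ampNorm_nonneg _)).1 ?_
  simpa only [ampNorm_sq, Function.comp_apply] using Equiv.sum_comp e fun s => ‖ψ s‖ ^ 2

theorem ampNorm_mulVec_unitary [DecidableEq ι] (U : Matrix.unitaryGroup ι ℂ) (ψ : ι → ℂ) :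
    ampNorm (U.1.mulVec ψ) = ampNorm ψ := by
  have ampNorm_sq_eq (φ : ι → ℂ) : ((ampNorm φ ^ 2 : ℝ) : ℂ) = star φ ⬝ᵥ φ := by
    simp [ampNorm_sq, dotProduct, Complex.conj_mul']
  have hU : star (U.1.mulVec ψ) ⬝ᵥ (U.1.mulVec ψ) = star ψ ⬝ᵥ ψ := by
    rw [Matrix.star_mulVec, Matrix.dotProduct_mulVec, Matrix.vecMul_vecMul,
      ← Matrix.star_eq_conjTranspose, Matrix.mem_unitaryGroup_iff'.1 U.2, Matrix.vecMul_one]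
  rw [← ampNorm_sq_eq, ← ampNorm_sq_eq] at hU
  exact (sq_eq_sq₀ (ampNorm_nonneg _) (ampNorm_nonneg _)).1 (by exact_mod_cast hU)

open Classical in
theorem ampNorm_indicator_sq (S : Set ι) (ψ : ι → ℂ) :
    ampNorm (S.indicator ψ) ^ 2 = ∑ s with s ∈ S, ‖ψ s‖ ^ 2 := by
  simp only [ampNorm_sq, Finset.sum_filter, Set.indicator_apply]
  refine Finset.sum_congr rfl fun s _ => ?_
  split_ifs <;> simp

theorem ampNorm_indicator_le (S : Set ι) (ψ : ι → ℂ) : ampNorm (S.indicator ψ) ≤ ampNorm ψ := by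
  classical
  refine le_of_sq_le_sq ?_ (ampNorm_nonneg _)
  rw [ampNorm_indicator_sq, ampNorm_sq]
  exact Finset.sum_le_sum_of_subset_of_nonneg (Finset.filter_subset _ _) fun _ _ _ => sq_nonneg _

end AmpNorm

/-! ### The hybrid argument -/

section Oracle

variable {n M : ℕ} [NeZero M] {W : Type}

/-- The permutation `|i, b, w⟩ ↦ |i, b + x_i mod M, w⟩` of the basis states underlying the query
operator. -/
def oraclePerm (x : Fin n → Fin M) : Equiv.Perm (Basis n M W) where
  toFun
    | (some i, b, w) => (some i, b + x i, w)
    | (none, b, w) => (none, b, w)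
  invFun
    | (some i, b, w) => (some i, b - x i, w)
    | (none, b, w) => (none, b, w)
  left_inv := by rintro ⟨_ | i, b, w⟩ <;> simp
  right_inv := by rintro ⟨_ | i, b, w⟩ <;> simp

theorem oracle_eq_comp_symm (x : Fin n → Fin M) (ψ : Basis n M W → ℂ) :
    oracle x ψ = ψ ∘ (oraclePerm x).symm := by
  funext ⟨i, b, w⟩
  cases i <;> rfl

theorem oracle_sub (x : Fin n → Fin M) (ψ φ : Basis n M W → ℂ) :
    oracle x (ψ - φ) = oracle x ψ - oracle x φ := by
  simp only [oracle_eq_comp_symm, Pi.sub_comp]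

theorem ampNorm_oracle [Fintype W] (x : Fin n → Fin M) (ψ : Basis n M W → ℂ) :
    ampNorm (oracle x ψ) = ampNorm ψ := by
  rw [oracle_eq_comp_symm, ampNorm_comp_perm]

end Oracle

section QueryWeight

variable {n M : ℕ} {W : Type} [Fintype W]

/-- The probability weight with which the index `i` is queried in the state `ψ`. -/
noncomputable def queryWeight (ψ : Basis n M W → ℂ) (i : Fin n) : ℝ :=
  ∑ p : Fin M × W, ‖ψ (some i, p)‖ ^ 2

theorem queryWeight_nonneg (ψ : Basis n M W → ℂ) (i : Fin n) : 0 ≤ queryWeight ψ i :=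
  Finset.sum_nonneg fun _ _ => sq_nonneg _

theorem ampNorm_sq_eq_add_sum_queryWeight (ψ : Basis n M W → ℂ) :
    ampNorm ψ ^ 2 = ∑ p : Fin M × W, ‖ψ (none, p)‖ ^ 2 + ∑ i, queryWeight ψ i := by
  rw [ampNorm_sq, Fintype.sum_prod_type, Fintype.sum_option]
  rfl

theorem sum_queryWeight_le (ψ : Basis n M W → ℂ) : ∑ i, queryWeight ψ i ≤ ampNorm ψ ^ 2 := by
  rw [ampNorm_sq_eq_add_sum_queryWeight]
  exact le_add_of_nonneg_left (Finset.sum_nonneg fun _ _ => sq_nonneg _)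

theorem ampNorm_oracle_sub_oracle_sq_le [NeZero M] (x y : Fin n → Fin M) (ψ : Basis n M W → ℂ) :
    ampNorm (oracle x ψ - oracle y ψ) ^ 2 ≤ 4 * ∑ i with x i ≠ y i, queryWeight ψ i := by
  let χ : Basis n M W → ℂ := {s | ∃ i, s.1 = some i ∧ x i ≠ y i}.indicator ψ
  have norm_χ : ampNorm χ ^ 2 = ∑ i with x i ≠ y i, queryWeight ψ i := by
    rw [ampNorm_sq_eq_add_sum_queryWeight, Finset.sum_filter]
    simp only [queryWeight, χ, Set.indicator_apply, Set.mem_ofPred_eq, reduceCtorEq, false_and,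
      exists_false, if_false, norm_zero, Option.some.injEq, exists_eq_left', ne_eq, zero_pow,
      OfNat.ofNat_ne_zero, not_false_eq_true, Finset.sum_const_zero, zero_add]
    refine Finset.sum_congr rfl fun i _ => ?_
    split_ifs <;> simp
  have oracle_sub_eq : oracle x ψ - oracle y ψ = oracle x χ - oracle y χ := by
    funext ⟨i, b, w⟩
    cases i with
    | none => simp [oracle]
    | some i => by_cases hi : x i = y i <;> simp [oracle, χ, hi]
  have hle : ampNorm (oracle x χ - oracle y χ) ≤ 2 * ampNorm χ := by
    refine (ampNorm_sub_le _ _).trans_eq ?_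
    rw [ampNorm_oracle, ampNorm_oracle, two_mul]
  calc ampNorm (oracle x ψ - oracle y ψ) ^ 2 ≤ (2 * ampNorm χ) ^ 2 := by
        rw [oracle_sub_eq]
        exact pow_le_pow_left₀ (ampNorm_nonneg _) hle 2
    _ = 4 * ∑ i with x i ≠ y i, queryWeight ψ i := by rw [mul_pow, norm_χ]; norm_num

end QueryWeight

/-- Around every input `z` the function `F` varies in a way controlled by a nonnegative weight on
the indices of total mass at most `K`. -/
def HasQueryMass {ι α : Type*} [Fintype ι] [DecidableEq α] (F : (ι → α) → ℝ) (K : ℝ) : Prop :=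
  ∀ z, ∃ ν : ι → ℝ, (∀ i, 0 ≤ ν i) ∧ ∑ i, ν i ≤ K ∧
    ∀ y, (F z - F y) ^ 2 ≤ ∑ i with z i ≠ y i, ν i

theorem HasQueryMass.eq_of_nonpos {ι α : Type*} [Fintype ι] [DecidableEq α] {F : (ι → α) → ℝ}
    {K : ℝ} (hF : HasQueryMass F K) (hK : K ≤ 0) (y z : ι → α) : F y = F z := by
  obtain ⟨ν, hν, hsum, hle⟩ := hF y
  have sq_nonpos : (F y - F z) ^ 2 ≤ 0 := calc
    (F y - F z) ^ 2 ≤ ∑ i with y i ≠ z i, ν i := hle z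
    _ ≤ ∑ i, ν i :=
      Finset.sum_le_sum_of_subset_of_nonneg (Finset.filter_subset _ _) fun i _ _ => hν i
    _ ≤ 0 := hsum.trans hK
  exact sub_eq_zero.1 (pow_eq_zero_iff two_ne_zero |>.1 (sq_nonpos.antisymm (sq_nonneg _)))

namespace QuantumAlgorithm

variable {n M : ℕ} (A : QuantumAlgorithm n M)

theorem ampNorm_state [NeZero M] (x : Fin n → Fin M) (q : ℕ) : ampNorm (A.state x q) = 1 := by
  induction q with
  | zero => rw [state, ampNorm_mulVec_unitary, ampNorm_single]
  | succ q ih => rw [state, ampNorm_mulVec_unitary, ampNorm_oracle, ih]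

theorem ampNorm_state_sub_le [NeZero M] (x y : Fin n → Fin M) (q : ℕ) :
    ampNorm (A.state x q - A.state y q) ≤
      ∑ k ∈ Finset.range q, ampNorm (oracle x (A.state x k) - oracle y (A.state x k)) := by
  induction q with
  | zero => simp [state, ampNorm_zero]
  | succ q ih =>
    have hybrid : oracle x (A.state x q) - oracle y (A.state y q) =
        oracle y (A.state x q - A.state y q) +
          (oracle x (A.state x q) - oracle y (A.state x q)) := by
      rw [oracle_sub]
      abel
    rw [Finset.sum_range_succ, state, state, ← Matrix.mulVec_sub, ampNorm_mulVec_unitary, hybrid]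
    refine (ampNorm_add_le _ _).trans ?_
    rw [ampNorm_oracle]
    gcongr

theorem prob_eq_ampNorm_sq (q : ℕ) (x : Fin n → Fin M) (b : Bool) :
    A.prob q x b = ampNorm ({s | A.out s = b}.indicator (A.state x q)) ^ 2 := by
  rw [ampNorm_indicator_sq, prob]
  exact Finset.sum_congr (by ext; simp) fun _ _ => rfl

theorem abs_prob_sub_le [NeZero M] (x y : Fin n → Fin M) (q : ℕ) (b : Bool) :
    |A.prob q x b - A.prob q y b| ≤ 2 * ampNorm (A.state x q - A.state y q) := by
  let S : Set (Basis n M A.W) := {s | A.out s = b}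
  have norm_le_one (z : Fin n → Fin M) : ampNorm (S.indicator (A.state z q)) ≤ 1 :=
    (ampNorm_indicator_le _ _).trans_eq (A.ampNorm_state z q)
  have norm_sub_le : |ampNorm (S.indicator (A.state x q)) - ampNorm (S.indicator (A.state y q))| ≤
      ampNorm (A.state x q - A.state y q) := by
    refine (abs_ampNorm_sub_le _ _).trans ?_
    rw [← Set.indicator_sub']
    exact ampNorm_indicator_le _ _
  have hx := norm_le_one x
  have hy := norm_le_one y
  have hx0 := ampNorm_nonneg (S.indicator (A.state x q))
  have hy0 := ampNorm_nonneg (S.indicator (A.state y q))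
  rw [prob_eq_ampNorm_sq, prob_eq_ampNorm_sq, sq_sub_sq, abs_mul, abs_of_nonneg (by positivity)]
  exact mul_le_mul (by linarith) norm_sub_le (abs_nonneg _) zero_le_two

theorem prob_add_prob_not [NeZero M] (x : Fin n → Fin M) (q : ℕ) (b : Bool) :
    A.prob q x b + A.prob q x (!b) = 1 := by
  have h := ampNorm_sq (A.state x q)
  rw [ampNorm_state, ← Finset.sum_filter_add_sum_filter_not _ fun s => A.out s = b] at h
  simp only [prob, Bool.eq_not]
  linarith

theorem sq_prob_sub_le [NeZero M] (x y : Fin n → Fin M) (q : ℕ) (b : Bool) :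
    (A.prob q x b - A.prob q y b) ^ 2 ≤
      16 * q * ∑ k ∈ Finset.range q, ∑ i with x i ≠ y i, queryWeight (A.state x k) i := by
  let d (k : ℕ) : ℝ := ampNorm (oracle x (A.state x k) - oracle y (A.state x k))
  have cauchy_schwarz : (∑ k ∈ Finset.range q, d k) ^ 2 ≤ q * ∑ k ∈ Finset.range q, d k ^ 2 := by
    simpa only [Finset.card_range] using sq_sum_le_card_mul_sum_sq (s := Finset.range q) (f := d)
  calc (A.prob q x b - A.prob q y b) ^ 2
      ≤ (2 * ∑ k ∈ Finset.range q, d k) ^ 2 := by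
        rw [← sq_abs]
        refine pow_le_pow_left₀ (abs_nonneg _) ((A.abs_prob_sub_le x y q b).trans ?_) 2
        gcongr
        exact A.ampNorm_state_sub_le x y q
    _ ≤ 4 * (q * ∑ k ∈ Finset.range q, d k ^ 2) := by
        rw [mul_pow]
        linarith
    _ ≤ 4 * (q * ∑ k ∈ Finset.range q,
          4 * ∑ i with x i ≠ y i, queryWeight (A.state x k) i) := by
        gcongr
        exact ampNorm_oracle_sub_oracle_sq_le _ _ _
    _ = 16 * q * ∑ k ∈ Finset.range q, ∑ i with x i ≠ y i, queryWeight (A.state x k) i := by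
        rw [← Finset.mul_sum]
        ring

theorem hasQueryMass [NeZero M] (q : ℕ) (b : Bool) :
    HasQueryMass (fun x => A.prob q x b) (16 * q ^ 2) := by
  intro z
  refine ⟨fun i => 16 * q * ∑ k ∈ Finset.range q, queryWeight (A.state z k) i,
    fun i => mul_nonneg (by positivity) (Finset.sum_nonneg fun _ _ => queryWeight_nonneg _ _),
    ?_, fun y => ?_⟩
  · have sum_le : ∑ k ∈ Finset.range q, ∑ i, queryWeight (A.state z k) i ≤ q := by
      calc _ ≤ ∑ k ∈ Finset.range q, ampNorm (A.state z k) ^ 2 :=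
            Finset.sum_le_sum fun k _ => sum_queryWeight_le _
        _ = q := by simp [ampNorm_state]
    rw [← Finset.mul_sum, Finset.sum_comm]
    calc _ ≤ 16 * q * (q : ℝ) := by gcongr
      _ = 16 * (q : ℝ) ^ 2 := by ring
  · rw [← Finset.mul_sum, Finset.sum_comm]
    exact A.sq_prob_sub_le z y q b

end QuantumAlgorithm

/-! ### Reading the whole input -/

section ReadAll

open Equiv

theorem permMatrix_mem_unitaryGroup {ι : Type*} [Fintype ι] [DecidableEq ι] (e : Perm ι) :
    e.permMatrix ℂ ∈ Matrix.unitaryGroup ι ℂ := by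
  rw [Matrix.mem_unitaryGroup_iff', Matrix.star_eq_conjTranspose, Matrix.conjTranspose_permMatrix,
    ← Matrix.permMatrix_mul, mul_inv_cancel, Matrix.permMatrix_one]

namespace QuantumAlgorithm

variable {n M : ℕ} {W : Type} [Fintype W] [DecidableEq W]

/-- The quantum algorithm that applies the permutation `e` of the basis states before, between and
after the queries; all its states are basis states. -/
abbrev ofPerm (e : Perm (Basis n M W)) (init : Basis n M W) (out : Basis n M W → Bool) :
    QuantumAlgorithm n M where
  W := W
  init := init
  U _ := ⟨e⁻¹.permMatrix ℂ, permMatrix_mem_unitaryGroup _⟩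
  out := out

variable [NeZero M] (e : Perm (Basis n M W)) (init : Basis n M W) (out : Basis n M W → Bool)

theorem state_ofPerm (x : Fin n → Fin M) (q : ℕ) :
    (ofPerm e init out).state x q = Pi.single ((fun s => e (oraclePerm x s))^[q] (e init)) 1 := by
  have single_comp_symm (σ : Perm (Basis n M W)) (s : Basis n M W) :
      (Pi.single s 1 : Basis n M W → ℂ) ∘ σ.symm = Pi.single (σ s) 1 := by
    rw [Pi.single_comp_equiv, symm_symm]
  induction q with
  | zero => exact (Matrix.permMatrix_mulVec _).trans (single_comp_symm e init)
  | succ q ih =>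
    rw [state, ih, oracle_eq_comp_symm, Function.iterate_succ_apply']
    exact (Matrix.permMatrix_mulVec _).trans <|
      (congrArg (· ∘ e.symm) (single_comp_symm _ _)).trans (single_comp_symm e _)

theorem prob_ofPerm_eq_zero (x : Fin n → Fin M) (q : ℕ) {b : Bool}
    (h : out ((fun s => e (oraclePerm x s))^[q] (e init)) ≠ b) :
    (ofPerm e init out).prob q x b = 0 := by
  refine Finset.sum_eq_zero fun s hs => ?_
  have hs_ne : s ≠ (fun s => e (oraclePerm x s))^[q] (e init) := by
    rintro rfl
    exact h (Finset.mem_filter.1 hs).2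
  rw [state_ofPerm, Pi.single_eq_of_ne hs_ne, norm_zero, zero_pow two_ne_zero]

end QuantumAlgorithm

variable {n M : ℕ}

/-- Exchange the answer register with the workspace cell addressed by the query register. -/
def exchangeAnswer : Perm (Basis n M (Fin n → Fin M)) :=
  Function.Involutive.toPerm
    (fun
      | (some i, b, w) => (some i, w i, Function.update w i b)
      | (none, b, w) => (none, b, w))
    (by rintro ⟨_ | i, b, w⟩ <;> simp)

/-- Rotate the query register through `none, some 0, …, some (n - 1)`. -/
def advanceQuery : Perm (Option (Fin n)) := (finSuccEquiv n).permCongr (Equiv.addRight 1)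

/-- Store the last answer in the workspace and move on to the next index. -/
def readNext : Perm (Basis n M (Fin n → Fin M)) :=
  exchangeAnswer.trans (advanceQuery.prodCongr (Equiv.refl _))

theorem advanceQuery_finSuccEquiv (j : Fin (n + 1)) :
    advanceQuery (finSuccEquiv n j) = finSuccEquiv n (j + 1) := by
  simp [advanceQuery]

theorem readNext_none (b : Fin M) (w : Fin n → Fin M) :
    readNext (none, b, w) = (advanceQuery none, b, w) := rfl

theorem readNext_some (i : Fin n) (b : Fin M) (w : Fin n → Fin M) :
    readNext (some i, b, w) = (advanceQuery (some i), w i, Function.update w i b) := rfl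

theorem iterate_readNext [NeZero M] (x : Fin n → Fin M) {k : ℕ} (hk : k ≤ n) :
    (fun s => readNext (oraclePerm x s))^[k] (readNext (none, 0, 0)) =
      (finSuccEquiv n (Fin.ofNat _ k + 1), 0, fun i => if i.1 < k then x i else 0) := by
  induction k with
  | zero =>
    rw [Function.iterate_zero_apply, readNext_none, ← finSuccEquiv_zero, advanceQuery_finSuccEquiv]
    simp [Pi.zero_def]
  | succ k ih =>
    have ofNat_succ : Fin.ofNat (n + 1) k + 1 = Fin.ofNat (n + 1) (k + 1) := by
      ext
      simp [Fin.val_add]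
    have addressed_index : finSuccEquiv n (Fin.ofNat (n + 1) (k + 1)) = some ⟨k, hk⟩ := by
      rw [← finSuccEquiv_succ]
      congr 1
      ext
      exact Nat.mod_eq_of_lt (Nat.succ_lt_succ hk)
    rw [Function.iterate_succ_apply', ih (by lia), ofNat_succ, ← advanceQuery_finSuccEquiv,
      addressed_index]
    refine (readNext_some _ _ _).trans (Prod.ext rfl (Prod.ext (by simp) (funext fun i => ?_)))
    rcases eq_or_ne i ⟨k, hk⟩ with rfl | hi
    · simp
    · have : i.1 < k ↔ i.1 < k + 1 := by
        have := Fin.val_ne_of_ne hi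
        grind
      simp [hi, this]

theorem quantumComputable_self [NeZero M] {X : Set (Fin n → Fin M)} (f : X → Bool) :
    QuantumComputable f n := by
  classical
  let out (s : Basis n M (Fin n → Fin M)) : Bool := if h : s.2.2 ∈ X then f ⟨s.2.2, h⟩ else false
  refine ⟨.ofPerm readNext (none, 0, 0) out, fun x => ?_⟩
  rw [QuantumAlgorithm.prob_ofPerm_eq_zero]
  · norm_num
  · rw [iterate_readNext x.1 le_rfl]
    simp [out]

end ReadAll

/-! ### Counting symbols and matching types -/

theorem exists_subset_card_eq_card_mul_sum_le {ι : Type*} (ν : ι → ℝ) (S : Finset ι) {e : ℕ}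
    (he : e ≤ S.card) : ∃ T ⊆ S, T.card = e ∧ S.card * ∑ i ∈ T, ν i ≤ e * ∑ i ∈ S, ν i := by
  classical
  obtain ⟨d, hd⟩ := Nat.exists_eq_add_of_le he
  induction d generalizing S with
  | zero => exact ⟨S, subset_rfl, by lia, by simp [hd]⟩
  | succ d ih =>
    rcases Nat.eq_zero_or_pos e with rfl | he_pos
    · exact ⟨∅, by simp⟩
    obtain ⟨i, hi, hmax⟩ := Finset.exists_max_image S ν (Finset.card_pos.1 (by lia))
    have card_erase := Finset.card_erase_of_mem hi
    obtain ⟨T, hTS, hTe, hT⟩ := ih (S.erase i) (by lia) (by lia)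
    refine ⟨T, hTS.trans (Finset.erase_subset _ _), hTe, ?_⟩
    have sum_le : ∑ j ∈ S, ν j ≤ S.card * ν i := by
      simpa using Finset.sum_le_card_nsmul S ν (ν i) hmax
    have sum_erase := Finset.add_sum_erase S ν hi
    rw [card_erase, Nat.cast_pred (by lia)] at hT
    have one_lt : (1 : ℝ) < S.card := by exact_mod_cast (by lia : 1 < S.card)
    refine le_of_mul_le_mul_left ?_ (sub_pos.2 one_lt)
    calc (S.card - 1) * (S.card * ∑ j ∈ T, ν j)
        = S.card * ((S.card - 1) * ∑ j ∈ T, ν j) := by ring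
      _ ≤ S.card * (e * ∑ j ∈ S.erase i, ν j) := by gcongr
      _ = e * (S.card * ∑ j ∈ S, ν j - S.card * ν i) := by rw [← sum_erase]; ring
      _ ≤ e * (S.card * ∑ j ∈ S, ν j - ∑ j ∈ S, ν j) := by gcongr
      _ = (S.card - 1) * (e * ∑ j ∈ S, ν j) := by ring

section Count

variable {ι α : Type*} [Fintype ι] [DecidableEq α]

/-- The number of occurrences of the symbol `a` in `z`; these numbers form the type of `z`. -/
def count (z : ι → α) (a : α) : ℕ := Finset.card {i | z i = a}

theorem sum_count_eq_card (z : ι → α) (U : Finset α) :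
    ∑ a ∈ U, count z a = Finset.card {i | z i ∈ U} := by
  rw [Finset.card_eq_sum_card_fiberwise (f := z) (t := U) (by intro i hi; simpa using hi)]
  refine Finset.sum_congr rfl fun a ha => congrArg Finset.card ?_
  ext i
  simp only [Finset.mem_filter, Finset.mem_univ, true_and]
  exact ⟨fun h => ⟨h ▸ ha, h⟩, And.right⟩

theorem sum_count [Fintype α] (z : ι → α) : ∑ a, count z a = Fintype.card ι := by
  simpa using sum_count_eq_card z Finset.univ

theorem count_le_count_add_card {z x : ι → α} {S : Finset ι} (h : ∀ i ∉ S, z i = x i) (a : α) :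
    count z a ≤ count x a + S.card := by
  classical
  refine (Finset.card_le_card fun i hi => ?_).trans (Finset.card_union_le _ _)
  by_cases hS : i ∈ S
  · exact Finset.mem_union_right _ hS
  · exact Finset.mem_union_left _ (by simpa [h i hS] using hi)

theorem sum_count_sub_le (y x : ι → α) (U : Finset α) :
    ∑ a ∈ U, ((count y a : ℝ) - count x a) ≤ Finset.card {i | y i ∈ U ∧ x i ∉ U} := by
  classical
  have card_le : Finset.card {i | y i ∈ U} ≤
      Finset.card {i | y i ∈ U ∧ x i ∉ U} + Finset.card {i | x i ∈ U} := by
    refine (Finset.card_le_card fun i hi => ?_).trans (Finset.card_union_le _ _)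
    by_cases h : x i ∈ U <;> simp_all
  rw [← sum_count_eq_card, ← sum_count_eq_card] at card_le
  rw [Finset.sum_sub_distrib, sub_le_iff_le_add]
  exact_mod_cast card_le

theorem count_update [DecidableEq ι] (z : ι → α) (i : ι) (b a : α) :
    (count (Function.update z i b) a : ℝ) =
      count z a - (if z i = a then 1 else 0) + if b = a then 1 else 0 := by
  have count_eq (y : ι → α) : (count y a : ℝ) =
      (if y i = a then 1 else 0) + ∑ j ∈ Finset.univ.erase i, if y j = a then 1 else 0 := by
    rw [Finset.add_sum_erase _ (fun j => if y j = a then (1 : ℝ) else 0) (Finset.mem_univ i),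
      count, Finset.card_filter]
    push_cast
    rfl
  have sum_eq : (∑ j ∈ Finset.univ.erase i, if Function.update z i b j = a then (1 : ℝ) else 0) =
      ∑ j ∈ Finset.univ.erase i, if z j = a then 1 else 0 :=
    Finset.sum_congr rfl fun j hj => by rw [Function.update_of_ne (Finset.ne_of_mem_erase hj)]
  rw [count_eq, count_eq z, sum_eq, Function.update_self]
  ring

theorem exists_subset_fiber_sum_le (z : ι → α) {ν : ι → ℝ} (hν : ∀ i, 0 ≤ ν i) {p : ℝ}
    (hp : 0 ≤ p) {a : α} {k : ℕ} (h : (count z a : ℝ) - k ≤ p * count z a) :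
    ∃ T ⊆ ({i | z i = a} : Finset ι), count z a ≤ T.card + k ∧
      ∑ i ∈ T, ν i ≤ p * ∑ i with z i = a, ν i := by
  have sum_nonneg : 0 ≤ ∑ i with z i = a, ν i := Finset.sum_nonneg fun i _ => hν i
  rcases le_or_gt (count z a) k with hle | hlt
  · exact ⟨∅, by simp, by simpa using hle, by simpa using mul_nonneg hp sum_nonneg⟩
  obtain ⟨T, hTsub, hTcard, hT⟩ := exists_subset_card_eq_card_mul_sum_le ν
    (Finset.univ.filter fun i => z i = a) (Nat.sub_le (count z a) k)
  refine ⟨T, hTsub, by lia, ?_⟩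
  have count_pos : (0 : ℝ) < count z a := Nat.cast_pos.2 (by lia)
  refine le_of_mul_le_mul_left ?_ count_pos
  calc count z a * ∑ i ∈ T, ν i
      ≤ (count z a - k : ℕ) * ∑ i with z i = a, ν i := hT
    _ ≤ p * count z a * ∑ i with z i = a, ν i := by
        rw [Nat.cast_sub hlt.le]
        gcongr
    _ = count z a * (p * ∑ i with z i = a, ν i) := by ring

theorem exists_perm_forall_notMem_eq [DecidableEq ι] {z t : ι → α} {T : Finset ι}
    (h : ∀ a, Finset.card {i | i ∉ T ∧ z i = a} ≤ count t a) :
    ∃ σ : Equiv.Perm ι, ∀ i ∉ T, t (σ i) = z i := by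
  have fiber_embedding (a : α) :
      Nonempty ({i : {i // i ∉ T} // z i = a} ↪ {j // t j = a}) := by
    refine Function.Embedding.nonempty_of_card_le ?_
    rw [Fintype.card_congr (Equiv.subtypeSubtypeEquivSubtypeInter (· ∉ T) fun i => z i = a),
      Fintype.card_subtype, Fintype.card_subtype]
    exact h a
  let g (a : α) := (fiber_embedding a).some
  let e (i : {i // i ∉ T}) : ι := g (z i) ⟨i, rfl⟩
  have t_e (i) : t (e i) = z i := (g (z i) ⟨i, rfl⟩).2
  have g_injective {a : α} {i j} (h : (g a i : ι) = g a j) : i = j :=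
    (g a).injective (Subtype.ext h)
  have e_injective : Function.Injective e := by
    rintro i j hij
    have z_eq : z i = z j := by rw [← t_e i, hij, t_e j]
    have e_eq {a : α} (h : z i = a) : e i = g a ⟨i, h⟩ := by subst h; rfl
    exact congrArg Subtype.val (g_injective ((e_eq z_eq).symm.trans hij))
  obtain ⟨σ, hσ⟩ := Equiv.Perm.exists_extending_pair _ e Subtype.val_injective e_injective
  exact ⟨σ, fun i hi => (congrArg t (hσ ⟨i, hi⟩)).trans (t_e ⟨i, hi⟩)⟩

theorem exists_perm_sum_ne_le {z t : ι → α} {ν : ι → ℝ} (hν : ∀ i, 0 ≤ ν i) {p : ℝ}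
    (hp : 0 ≤ p) (h : ∀ a, (count z a : ℝ) - count t a ≤ p * count z a) :
    ∃ σ : Equiv.Perm ι, ∑ i with z i ≠ t (σ i), ν i ≤ p * ∑ i, ν i := by
  classical
  choose T hTsub hTcard hTν using fun a => exists_subset_fiber_sum_le z hν hp (h a)
  let T' : Finset ι := {i | i ∈ T (z i)}
  have card_rest (a : α) : Finset.card {i | i ∉ T' ∧ z i = a} ≤ count t a := by
    have card_le : Finset.card {i | i ∉ T' ∧ z i = a} ≤
        ((Finset.univ.filter fun i => z i = a) \ T a).card :=
      Finset.card_le_card fun i hi => by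
        obtain ⟨hiT, rfl⟩ : i ∉ T (z i) ∧ z i = a := by simpa [T'] using hi
        simpa using hiT
    have card_sdiff : (_ \ T a).card = count z a - (T a).card :=
      Finset.card_sdiff_of_subset (hTsub a)
    have := hTcard a
    lia
  obtain ⟨σ, hσ⟩ := exists_perm_forall_notMem_eq card_rest
  refine ⟨σ, ?_⟩
  calc ∑ i with z i ≠ t (σ i), ν i
      ≤ ∑ i ∈ T', ν i := by
        refine Finset.sum_le_sum_of_subset_of_nonneg (fun i hi => ?_) fun i _ _ => hν i
        by_contra hiT
        exact (Finset.mem_filter.1 hi).2 (hσ i hiT).symm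
    _ = ∑ a ∈ Finset.univ.image z, ∑ i ∈ T' with z i = a, ν i :=
        (Finset.sum_fiberwise_of_maps_to (fun i _ => Finset.mem_image_of_mem z (by simp)) ν).symm
    _ ≤ ∑ a ∈ Finset.univ.image z, p * ∑ i with z i = a, ν i := by
        refine Finset.sum_le_sum fun a _ => le_trans ?_ (hTν a)
        refine Finset.sum_le_sum_of_subset_of_nonneg (fun i hi => ?_) fun i _ _ => hν i
        obtain ⟨hiT, rfl⟩ : i ∈ T (z i) ∧ z i = a := by simpa [T'] using hi
        exact hiT
    _ = p * ∑ i, ν i := by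
        rw [← Finset.mul_sum, Finset.sum_fiberwise_of_maps_to fun i _ =>
          Finset.mem_image_of_mem z (Finset.mem_univ i)]

end Count

/-! ### Block sensitivity and certificates -/

section Certificate

variable {ι α β : Type*} [Fintype ι] [DecidableEq α]

/-- The set of indices where `x` and `y` differ. -/
def diff (x y : ι → α) : Finset ι := {i | x i ≠ y i}

theorem mem_diff {x y : ι → α} {i : ι} : i ∈ diff x y ↔ x i ≠ y i := by simp [diff]

theorem diff_nonempty {x y : ι → α} : (diff x y).Nonempty ↔ x ≠ y := by
  simp [Finset.Nonempty, mem_diff, Function.ne_iff]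

theorem diff_self_update_subset [DecidableEq ι] (x : ι → α) (i : ι) (b : α) :
    diff x (Function.update x i b) ⊆ {i} := by
  intro j hj
  by_contra hji
  exact mem_diff.1 hj (Function.update_of_ne (by simpa using hji) b x).symm

theorem diff_update_ssubset [DecidableEq ι] {x y : ι → α} {i : ι} (h : x i ≠ y i) :
    diff x (Function.update y i (x i)) ⊂ diff x y := by
  refine (Finset.ssubset_iff_of_subset fun j hj => ?_).2 ⟨i, mem_diff.2 h, by simp [mem_diff]⟩
  rw [mem_diff] at hj ⊢
  rcases eq_or_ne j i with rfl | hji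
  · exact h
  · rwa [Function.update_of_ne hji] at hj

/-- The block sensitivity of `g` on the promise `D` is at most `B`: for no `x ∈ D` are there more
than `B` pairwise disjoint blocks of indices such that `g` can be changed by changing `x` inside any
one of them, staying in `D`. -/
def BlockSensitivityLE (D : Set (ι → α)) (g : (ι → α) → β) (B : ℕ) : Prop :=
  ∀ x ∈ D, ∀ 𝓑 : Finset (Finset ι), (𝓑 : Set (Finset ι)).PairwiseDisjoint id →
    (∀ b ∈ 𝓑, ∃ y ∈ D, diff x y ⊆ b ∧ g y ≠ g x) → 𝓑.card ≤ B

/-- Reading the indices `S` of `x` determines `g x` under the promise `D`. -/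
def IsCertificate (D : Set (ι → α)) (g : (ι → α) → β) (x : ι → α) (S : Finset ι) : Prop :=
  ∀ y ∈ D, (∀ i ∈ S, y i = x i) → g y = g x

/-- `y` differs from `x` on an inclusion-minimal set of indices among the elements of `D` at which
`g` takes another value than at `x`. -/
def IsMinimalFlip (D : Set (ι → α)) (g : (ι → α) → β) (x y : ι → α) : Prop :=
  y ∈ D ∧ g y ≠ g x ∧ ∀ y' ∈ D, g y' ≠ g x → ¬ diff x y' ⊂ diff x y

variable {D D' : Set (ι → α)} {g : (ι → α) → β} {x y : ι → α} {B L : ℕ}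

theorem BlockSensitivityLE.mono (h : BlockSensitivityLE D g B) (hD : D' ⊆ D) :
    BlockSensitivityLE D' g B := fun x hx 𝓑 hdisj h𝓑 =>
  h x (hD hx) 𝓑 hdisj fun b hb =>
    let ⟨y, hy, hyb⟩ := h𝓑 b hb
    ⟨y, hD hy, hyb⟩

theorem BlockSensitivityLE.card_le_of_update [DecidableEq ι] (h : BlockSensitivityLE D g B)
    (hx : x ∈ D) {P : Finset ι}
    (hP : ∀ i ∈ P, ∃ b, Function.update x i b ∈ D ∧ g (Function.update x i b) ≠ g x) :
    P.card ≤ B := by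
  have := h x hx (P.image fun i => {i}) ?_ ?_
  · rwa [Finset.card_image_of_injective _ Finset.singleton_injective] at this
  · rw [Finset.coe_image]
    rintro _ ⟨i, _, rfl⟩ _ ⟨j, _, rfl⟩ hij
    simpa [Function.onFun] using ne_of_apply_ne _ hij
  · simp only [Finset.forall_mem_image]
    intro i hi
    obtain ⟨b, hb⟩ := hP i hi
    exact ⟨_, hb.1, diff_self_update_subset x i b, hb.2⟩

theorem exists_isMinimalFlip_diff_subset (hy : y ∈ D) (hne : g y ≠ g x) :
    ∃ y', IsMinimalFlip D g x y' ∧ diff x y' ⊆ diff x y := by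
  obtain ⟨b, hb, ⟨y', hy', hne', rfl⟩, hmin⟩ := exists_minimal_le_of_wellFoundedLT
    (fun b => ∃ y' ∈ D, g y' ≠ g x ∧ diff x y' = b) (diff x y) ⟨y, hy, hne, rfl⟩
  exact ⟨y', ⟨hy', hne', fun z hz hzne hss => hss.2 (hmin ⟨z, hz, hzne, rfl⟩ hss.1)⟩, hb⟩

/-- The union of a maximal family of disjoint minimal blocks meets every block. -/
theorem exists_isCertificate (h : BlockSensitivityLE D g B) (hx : x ∈ D)
    (hL : ∀ y, IsMinimalFlip D g x y → (diff x y).card ≤ L) :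
    ∃ S : Finset ι, S.card ≤ B * L ∧ IsCertificate D g x S := by
  classical
  let families : Finset (Finset (Finset ι)) := {𝓑 | (𝓑 : Set (Finset ι)).PairwiseDisjoint id ∧
    ∀ b ∈ 𝓑, ∃ y, IsMinimalFlip D g x y ∧ diff x y = b}
  obtain ⟨𝓑, h𝓑, hmax⟩ := Finset.exists_max_image families Finset.card ⟨∅, by simp [families]⟩
  obtain ⟨hdisj, hflip⟩ := (Finset.mem_filter.1 h𝓑).2
  have card_family_le : 𝓑.card ≤ B := h x hx 𝓑 hdisj fun b hb => by
    obtain ⟨y, hy, rfl⟩ := hflip b hb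
    exact ⟨y, hy.1, subset_rfl, hy.2.1⟩
  have card_block_le : ∀ b ∈ 𝓑, b.card ≤ L := fun b hb => by
    obtain ⟨y, hy, rfl⟩ := hflip b hb
    exact hL y hy
  refine ⟨𝓑.biUnion id, (Finset.card_biUnion_le_card_mul _ _ L card_block_le).trans
    (Nat.mul_le_mul_right L card_family_le), fun y hy hS => ?_⟩
  by_contra hne
  obtain ⟨y', hy', hsub⟩ := exists_isMinimalFlip_diff_subset hy hne
  have disjoint_family : ∀ b ∈ 𝓑, Disjoint (diff x y') b := fun b hb =>
    Finset.disjoint_left.2 fun i hi hib =>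
      mem_diff.1 (hsub hi) (hS i (Finset.mem_biUnion.2 ⟨b, hb, hib⟩)).symm
  have diff_notMem : diff x y' ∉ 𝓑 := fun hmem =>
    (diff_nonempty.2 fun h => hy'.2.1 (congrArg g h.symm)).ne_empty
      (disjoint_self.1 (disjoint_family _ hmem))
  have insert_mem : insert (diff x y') 𝓑 ∈ families := by
    simp only [families, Finset.mem_filter, Finset.mem_univ, true_and, Finset.mem_insert,
      forall_eq_or_imp, Finset.coe_insert]
    exact ⟨hdisj.insert fun b hb _ => disjoint_family b hb, ⟨y', hy', rfl⟩, hflip⟩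
  have := hmax _ insert_mem
  rw [Finset.card_insert_of_notMem diff_notMem] at this
  lia

/-- Undoing a change at a single index of a minimal flip restores the value of `g`. -/
theorem IsMinimalFlip.card_le_of_update_mem [DecidableEq ι] (hy : IsMinimalFlip D g x y)
    (h : BlockSensitivityLE D g B) {P : Finset ι}
    (hP : ∀ i ∈ P, x i ≠ y i ∧ Function.update y i (x i) ∈ D) : P.card ≤ B :=
  h.card_le_of_update hy.1 fun i hi => ⟨x i, (hP i hi).2, fun hval =>
    hy.2.2 _ (hP i hi).2 (hval ▸ hy.2.1) (diff_update_ssubset (hP i hi).1)⟩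

end Certificate

section CountWindow

variable {ι α β : Type*} [Fintype ι] [DecidableEq α]

/-- The inputs in which the number of occurrences of each symbol `a ∈ A` is within `w` of `c a`. -/
def countWindow (A : Finset α) (c : α → ℝ) (w : ℝ) : Set (ι → α) :=
  {z | ∀ a ∈ A, |(count z a : ℝ) - c a| ≤ w}

variable {A : Finset α} {c : α → ℝ} {w : ℝ} {x y z : ι → α} {B : ℕ}

theorem mem_countWindow_two_mul_of_eq_off {S : Finset ι} (hx : x ∈ countWindow A c w)
    (hzx : ∀ i ∉ S, z i = x i) (hS : S.card ≤ w) : z ∈ countWindow A c (2 * w) := by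
  intro a ha
  have count_le : (count z a : ℝ) ≤ count x a + S.card := by
    exact_mod_cast count_le_count_add_card hzx a
  have le_count : (count x a : ℝ) ≤ count z a + S.card := by
    exact_mod_cast count_le_count_add_card (fun i hi => (hzx i hi).symm) a
  have := abs_le.1 (hx a ha)
  exact abs_le.2 ⟨by linarith, by linarith⟩

theorem update_mem_countWindow [DecidableEq ι] (hy : y ∈ countWindow A c w) {i : ι} {b : α}
    (hlow : y i ∈ A → c (y i) - w ≤ count y (y i) - 1) (hhigh : b ∈ A → count y b + 1 ≤ c b + w) :
    Function.update y i b ∈ countWindow A c w := by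
  intro a ha
  have hya := abs_le.1 (hy a ha)
  rw [count_update, abs_le]
  have low_le : y i = a → c a - w ≤ count y a - 1 := by
    rintro rfl
    exact hlow ha
  have le_high : b = a → count y a + 1 ≤ c a + w := by
    rintro rfl
    exact hhigh ha
  split_ifs with hia hba hba
  · constructor <;> linarith
  · have := low_le hia
    constructor <;> linarith
  · have := le_high hba
    constructor <;> linarith
  · constructor <;> linarith

theorem eq_empty_of_forall_lt_count_sub {U : Finset α}
    (hcard : Finset.card {i | y i ∈ U ∧ x i ∉ U} ≤ B)
    (hU : ∀ a ∈ U, (B : ℝ) < count y a - count x a) : U = ∅ := by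
  by_contra! hne
  obtain ⟨a, ha⟩ := hne
  have single_le : (count y a : ℝ) - count x a ≤ ∑ b ∈ U, ((count y b : ℝ) - count x b) :=
    Finset.single_le_sum (f := fun b => (count y b : ℝ) - count x b)
      (fun b hb => (Nat.cast_nonneg B).trans (hU b hb).le) ha
  have sum_le := sum_count_sub_le y x U
  have card_le : (Finset.card {i | y i ∈ U ∧ x i ∉ U} : ℝ) ≤ B := by exact_mod_cast hcard
  linarith [hU a ha]

/-- The symbols that `y` has almost too often, or almost too rarely, would all be gained, or all be
lost, when passing from `x` to `y`; undoing a single such change stays inside the window, so there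
are at most `B` of them. -/
theorem IsMinimalFlip.card_diff_le [DecidableEq ι] {g : (ι → α) → β} {G : Set (ι → α)}
    (hG : ∀ y ∈ G, ∀ i, Function.update y i (x i) ∈ G) (hx : x ∈ countWindow A c w)
    (hw : (B : ℝ) + 2 ≤ w) (hg : BlockSensitivityLE (countWindow A c (2 * w) ∩ G) g B)
    (hy : IsMinimalFlip (countWindow A c (2 * w) ∩ G) g x y) : (diff x y).card ≤ B := by
  have two_le : 2 ≤ w := by linarith [B.cast_nonneg (α := ℝ)]
  have card_le {P : Finset ι} (hne : ∀ i ∈ P, x i ≠ y i)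
      (hP : ∀ i ∈ P, Function.update y i (x i) ∈ countWindow A c (2 * w)) : P.card ≤ B :=
    hy.card_le_of_update_mem hg fun i hi => ⟨hne i hi, hP i hi, hG y hy.1.2 i⟩
  have count_succ_le : ∀ a ∈ A, (count y a : ℝ) + 1 ≤ c a + 2 * w := by
    have top_empty : A.filter (fun a => c a + 2 * w < count y a + 1) = ∅ := by
      refine eq_empty_of_forall_lt_count_sub (y := y) (x := x) (B := B) (card_le ?_ ?_) ?_
      · exact fun i hi hxy => (Finset.mem_filter.1 hi).2.2 (hxy ▸ (Finset.mem_filter.1 hi).2.1)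
      · simp only [Finset.mem_filter, Finset.mem_univ, true_and, not_and, not_lt, and_imp]
        exact fun i _ htop hxi =>
          update_mem_countWindow hy.1.1 (fun _ => by linarith only [two_le, htop]) hxi
      · simp only [Finset.mem_filter, and_imp]
        intro a ha htop
        linarith [(abs_le.1 (hx a ha)).2]
    simpa [Finset.filter_eq_empty_iff] using top_empty
  have le_count_pred : ∀ a ∈ A, c a - 2 * w ≤ (count y a : ℝ) - 1 := by
    have bottom_empty : A.filter (fun a => (count y a : ℝ) - 1 < c a - 2 * w) = ∅ := by
      refine eq_empty_of_forall_lt_count_sub (y := x) (x := y) (B := B) (card_le ?_ ?_) ?_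
      · exact fun i hi hxy => (Finset.mem_filter.1 hi).2.2 (hxy ▸ (Finset.mem_filter.1 hi).2.1)
      · simp only [Finset.mem_filter, Finset.mem_univ, true_and, not_and, not_lt, and_imp]
        exact fun i _ _ hyi => update_mem_countWindow hy.1.1 hyi (count_succ_le _)
      · simp only [Finset.mem_filter, and_imp]
        intro a ha hbot
        linarith [(abs_le.1 (hx a ha)).1]
    simpa only [Finset.filter_eq_empty_iff, not_lt] using bottom_empty
  exact card_le (fun i hi => mem_diff.1 hi) fun i _ =>
    update_mem_countWindow hy.1.1 (le_count_pred _) (count_succ_le _)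

theorem exists_isCertificate_countWindow [DecidableEq ι] {g : (ι → α) → β} {G : Set (ι → α)}
    (hG : ∀ y ∈ G, ∀ i, Function.update y i (x i) ∈ G) (hx : x ∈ countWindow A c w) (hxG : x ∈ G)
    (hw : (B : ℝ) + 2 ≤ w) (hg : BlockSensitivityLE (countWindow A c (2 * w) ∩ G) g B) :
    ∃ S : Finset ι, S.card ≤ B * B ∧ IsCertificate (countWindow A c (2 * w) ∩ G) g x S := by
  have hx' : x ∈ countWindow A c (2 * w) := fun a ha =>
    (hx a ha).trans (by linarith [B.cast_nonneg (α := ℝ)])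
  exact exists_isCertificate hg ⟨hx', hxG⟩ fun y hy => hy.card_diff_le hG hx hw hg

end CountWindow

section Decided

variable {ι α : Type*} {F : (ι → α) → ℝ} {x y : ι → α}

/-- The value of the bit that `F y`, read as the probability of the bit `1`, suggests. -/
noncomputable def side (F : (ι → α) → ℝ) (y : ι → α) : Bool := decide (1 / 2 < F y)

/-- `F y` is bounded away from `1 / 2`. -/
def Decided (F : (ι → α) → ℝ) (y : ι → α) : Prop := F y ≤ 2 / 5 ∨ 3 / 5 ≤ F y

theorem le_sq_sub_of_side_ne (hx : Decided F x) (hy : Decided F y) (h : side F y ≠ side F x) :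
    1 / 25 ≤ (F x - F y) ^ 2 := by
  have not_iff : ¬ (1 / 2 < F y ↔ 1 / 2 < F x) := by
    simpa only [side, ne_eq, decide_eq_decide] using h
  rcases hx with hx | hx <;> rcases hy with hy | hy
  · exact absurd (iff_of_false (by linarith) (by linarith)) not_iff
  · nlinarith
  · nlinarith
  · exact absurd (iff_of_true (by linarith) (by linarith)) not_iff

theorem HasQueryMass.blockSensitivityLE [Fintype ι] [DecidableEq α] {K : ℕ}
    (hF : HasQueryMass F K) {D : Set (ι → α)} (hD : ∀ y ∈ D, Decided F y) :
    BlockSensitivityLE D (side F) (25 * K) := by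
  intro x hx 𝓑 hdisj h
  obtain ⟨ν, hν, sum_le, hle⟩ := hF x
  have le_block_weight : ∀ b ∈ 𝓑, (1 / 25 : ℝ) ≤ ∑ i ∈ b, ν i := by
    intro b hb
    obtain ⟨y, hy, hyb, hne⟩ := h b hb
    exact (le_sq_sub_of_side_ne (hD x hx) (hD y hy) hne).trans ((hle y).trans
      (Finset.sum_le_sum_of_subset_of_nonneg hyb fun i _ _ => hν i))
  classical
  have card_mul_le : (𝓑.card : ℝ) * (1 / 25) ≤ K := by
    calc (𝓑.card : ℝ) * (1 / 25) ≤ ∑ b ∈ 𝓑, ∑ i ∈ b, ν i := by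
          simpa using Finset.card_nsmul_le_sum 𝓑 (fun b => ∑ i ∈ b, ν i) (1 / 25) le_block_weight
      _ = ∑ i ∈ 𝓑.biUnion id, ν i := (Finset.sum_biUnion hdisj).symm
      _ ≤ ∑ i, ν i :=
          Finset.sum_le_sum_of_subset_of_nonneg (Finset.subset_univ _) fun i _ _ => hν i
      _ ≤ K := sum_le
  have card_le : (𝓑.card : ℝ) ≤ 25 * K := by linarith
  exact_mod_cast card_le

end Decided

/-! ### Guessing from partially read inputs -/

section Guess

variable {ι α β : Type*}

/-- A rule that, from the entries `u` read at the indices `P`, proposes further indices to read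
together with a guess for the value to be computed. The values of `u` outside `P` carry no
information. -/
abbrev GuessRule (ι α β : Type*) : Type _ := Finset ι → (ι → α) → Finset ι × β

/-- Whenever the rule makes a guess other than `v` from entries of `y`, the indices that it proposes
contain an unread element of `S`. -/
def GuessRule.WrongGuessHits (pick : GuessRule ι α β) (y : ι → α) (v : β) (S : Finset ι) : Prop :=
  ∀ P u, (∀ i ∈ P, u i = y i) → (pick P u).2 ≠ v → ∃ i ∈ (pick P u).1, i ∈ S ∧ i ∉ P

variable [Fintype ι] [DecidableEq α]

/-- No symbol of `r` occurs more often in `z` than in `t`. -/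
def RareLE (r : Finset α) (z t : ι → α) : Prop := ∀ a ∈ r, count z a ≤ count t a

variable {A r : Finset α} {N : Set (ι → α)} {x y z t u : ι → α} {P S : Finset ι}
  {c : α → ℝ} {w : ℝ} {g : (ι → α) → β} {B : ℕ}

theorem RareLE.trans (hzy : RareLE r z y) (hyt : RareLE r y t) : RareLE r z t :=
  fun a ha => (hzy a ha).trans (hyt a ha)

theorem rareLE_of_forall_mem_eq (h : ∀ i, z i ∈ r → z i = y i) : RareLE r z y := by
  refine fun a ha => Finset.card_le_card fun i hi => ?_
  obtain rfl : z i = a := by simpa using hi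
  simpa using (h i ha).symm

/-- The inputs that, by the entries `u` read at the indices `P`, may be the given one, provided that
it has no rare symbol at an unread index. -/
def candidates (A r : Finset α) (c : α → ℝ) (w : ℝ) (N : Set (ι → α)) (P : Finset ι)
    (u : ι → α) : Set (ι → α) :=
  {x | x ∈ countWindow A c w ∧ x ∈ N ∧ (∀ i ∈ P, x i = u i) ∧ ∀ i, x i ∈ r → i ∈ P}

/-- The rare symbols at unread indices are replaced by the symbol `star`. -/
theorem candidates_nonempty (hN : ∀ y ∈ N, ∀ z, RareLE r z y → z ∈ N) (hrA : Disjoint r A)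
    {star : α} (hstarA : star ∉ A) (hstar : star ∉ r) (hy : y ∈ countWindow A c w) (hyN : y ∈ N)
    (hu : ∀ i ∈ P, u i = y i) : (candidates A r c w N P u).Nonempty := by
  classical
  let x : ι → α := fun i => if y i ∈ r ∧ i ∉ P then star else y i
  have x_eq_or (i) : (y i ∈ r ∧ i ∉ P ∧ x i = star) ∨ (¬ (y i ∈ r ∧ i ∉ P) ∧ x i = y i) := by
    by_cases h : y i ∈ r ∧ i ∉ P
    · exact Or.inl ⟨h.1, h.2, if_pos h⟩
    · exact Or.inr ⟨h, if_neg h⟩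
  refine ⟨x, fun a ha => ?_, hN y hyN x (rareLE_of_forall_mem_eq fun i hi => ?_), fun i hi => ?_,
    fun i hi => ?_⟩
  · have count_eq : count x a = count y a := by
      refine congrArg Finset.card (Finset.filter_congr fun i _ => ?_)
      rcases x_eq_or i with ⟨hr, -, hxi⟩ | ⟨-, hxi⟩
      · exact iff_of_false (fun h => hstarA (hxi ▸ h ▸ ha))
          fun h => Finset.disjoint_left.1 hrA hr (h ▸ ha)
      · rw [hxi]
    rw [count_eq]
    exact hy a ha
  · rcases x_eq_or i with ⟨-, -, hxi⟩ | ⟨-, hxi⟩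
    · exact absurd (hxi ▸ hi) hstar
    · exact hxi
  · rcases x_eq_or i with ⟨-, hiP, -⟩ | ⟨-, hxi⟩
    · exact absurd hi hiP
    · rw [hxi, hu i hi]
  · rcases x_eq_or i with ⟨-, -, hxi⟩ | ⟨hr, hxi⟩
    · exact absurd (hxi ▸ hi) hstar
    · by_contra hiP
      exact hr ⟨hxi ▸ hi, hiP⟩

theorem exists_certificate_of_mem_candidates (hN : ∀ y ∈ N, ∀ z, RareLE r z y → z ∈ N)
    (hw : (B : ℝ) + 2 ≤ w) (hg : BlockSensitivityLE (countWindow A c (2 * w) ∩ N) g B)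
    (hx : x ∈ candidates A r c w N P u) :
    ∃ S : Finset ι, S.card ≤ B * B ∧
      IsCertificate (countWindow A c (2 * w) ∩ (N ∩ {y | ∀ i ∈ P, y i = u i})) g x S := by
  classical
  obtain ⟨hxA, hxN, hxP, hxr⟩ := hx
  refine exists_isCertificate_countWindow (fun y hy i => ?_) hxA ⟨hxN, hxP⟩ hw
    (hg.mono (Set.inter_subset_inter_right _ Set.inter_subset_left))
  by_cases hi : i ∈ P
  · rwa [hxP i hi, ← hy.2 i hi, Function.update_eq_self]
  · refine ⟨hN y hy.1 _ (rareLE_of_forall_mem_eq fun j hj => ?_), fun j hj => ?_⟩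
    · rcases eq_or_ne j i with rfl | hji
      · exact absurd (hxr j (by simpa using hj)) hi
      · exact Function.update_of_ne hji _ _
    · rw [Function.update_of_ne (ne_of_mem_of_not_mem hj hi), hy.2 j hj]

theorem exists_certificate_of_mem_countWindow (hN : ∀ y ∈ N, ∀ z, RareLE r z y → z ∈ N)
    (hw : (B : ℝ) + 2 ≤ w) (hg : BlockSensitivityLE (countWindow A c (2 * w) ∩ N) g B)
    (hy : y ∈ countWindow A c w) (hyN : y ∈ N) :
    ∃ S : Finset ι, S.card ≤ B * B ∧
      IsCertificate (countWindow A c (2 * w) ∩ {z | ∀ i, z i ∈ r → z i = y i}) g y S := by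
  classical
  refine exists_isCertificate_countWindow (fun z hz i j hj => ?_) hy (fun _ _ => rfl) hw
    (hg.mono (Set.inter_subset_inter_right _ fun z hz => hN y hyN z (rareLE_of_forall_mem_eq hz)))
  rcases eq_or_ne j i with rfl | hji
  · exact Function.update_self _ _ _
  · rw [Function.update_of_ne hji] at hj ⊢
    exact hz j hj

/-- The input that agrees with `y` on the certificate `S` of `y`, and with `x` elsewhere, is
recognised by both certificates. -/
theorem eq_of_isCertificate_of_isCertificate (hN : ∀ y ∈ N, ∀ z, RareLE r z y → z ∈ N)
    (hx : x ∈ candidates A r c w N P u) (hyN : y ∈ N) (hu : ∀ i ∈ P, u i = y i) {S' : Finset ι}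
    (hS' : IsCertificate (countWindow A c (2 * w) ∩ (N ∩ {y | ∀ i ∈ P, y i = u i})) g x S')
    (hS : IsCertificate (countWindow A c (2 * w) ∩ {z | ∀ i, z i ∈ r → z i = y i}) g y S)
    (hSw : S.card ≤ w) (hinter : ∀ i ∈ S', i ∈ S → i ∈ P) : g x = g y := by
  classical
  obtain ⟨hxA, -, hxP, hxr⟩ := hx
  have x_eq_y {i} (hi : i ∈ P) : x i = y i := (hxP i hi).trans (hu i hi)
  let z : ι → α := fun i => if i ∈ S then y i else x i
  have z_eq_y {i} (hi : i ∈ S) : z i = y i := if_pos hi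
  have z_eq_x {i} (hi : i ∉ S) : z i = x i := if_neg hi
  have z_eq_x_of_imp {i} (hi : i ∈ S → i ∈ P) : z i = x i := by
    by_cases hiS : i ∈ S
    · rw [z_eq_y hiS, x_eq_y (hi hiS)]
    · exact z_eq_x hiS
  have z_window : z ∈ countWindow A c (2 * w) :=
    mem_countWindow_two_mul_of_eq_off hxA (fun i hi => z_eq_x hi) hSw
  have z_rare : ∀ i, z i ∈ r → z i = y i := fun i hi => by
    by_cases hiS : i ∈ S
    · exact z_eq_y hiS
    · rw [z_eq_x hiS] at hi ⊢
      exact x_eq_y (hxr i hi)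
  have z_near : z ∈ N := hN y hyN z (rareLE_of_forall_mem_eq z_rare)
  have z_read : ∀ i ∈ P, z i = u i := fun i hi => (z_eq_x_of_imp fun _ => hi).trans (hxP i hi)
  exact (hS' z ⟨z_window, z_near, z_read⟩ fun i hi => z_eq_x_of_imp (hinter i hi)).symm.trans
    (hS z ⟨z_window, z_rare⟩ fun i hi => z_eq_y hi)

theorem exists_guessRule (hN : ∀ y ∈ N, ∀ z, RareLE r z y → z ∈ N) (hrA : Disjoint r A) {star : α}
    (hstarA : star ∉ A) (hstar : star ∉ r) (hw : ((B * B : ℕ) : ℝ) + 2 ≤ w)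
    (hg : BlockSensitivityLE (countWindow A c (2 * w) ∩ N) g B) :
    ∃ pick : GuessRule ι α β, (∀ P u, (pick P u).1.card ≤ B * B) ∧
      ∀ y ∈ N, y ∈ countWindow A c w →
        ∃ S : Finset ι, S.card ≤ B * B ∧ pick.WrongGuessHits y (g y) S := by
  have hBw : (B : ℝ) + 2 ≤ w := by
    have : (B : ℝ) ≤ (B * B : ℕ) := by exact_mod_cast Nat.le_mul_self B
    linarith
  have exists_pick (P u) : ∃ p : Finset ι × β, p.1.card ≤ B * B ∧
      ((candidates A r c w N P u).Nonempty → ∃ x ∈ candidates A r c w N P u, p.2 = g x ∧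
        IsCertificate (countWindow A c (2 * w) ∩ (N ∩ {y | ∀ i ∈ P, y i = u i})) g x p.1) := by
    rcases (candidates A r c w N P u).eq_empty_or_nonempty with hempty | ⟨x, hx⟩
    · exact ⟨(∅, g u), by simp, fun h => absurd hempty h.ne_empty⟩
    · obtain ⟨S, hcard, hS⟩ := exists_certificate_of_mem_candidates hN hBw hg hx
      exact ⟨(S, g x), hcard, fun _ => ⟨x, hx, rfl, hS⟩⟩
  choose pick pick_card pick_spec using exists_pick
  refine ⟨pick, pick_card, fun y hyN hy => ?_⟩
  obtain ⟨S, hcard, hS⟩ := exists_certificate_of_mem_countWindow hN hBw hg hy hyN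
  have card_le : (S.card : ℝ) ≤ w := by
    have : (S.card : ℝ) ≤ (B * B : ℕ) := by exact_mod_cast hcard
    linarith
  refine ⟨S, hcard, fun P u hu hne => ?_⟩
  obtain ⟨x, hx, hguess, hcert⟩ :=
    pick_spec P u (candidates_nonempty hN hrA hstarA hstar hy hyN hu)
  by_contra! hinter
  exact hne (hguess.trans
    (eq_of_isCertificate_of_isCertificate hN hx hyN hu hcert hS card_le hinter))

end Guess

/-! ### Inputs of approximately known type -/

section ApproximateType

variable {ι α : Type*}

theorem HasQueryMass.exists_perm_sq_sub_le [Fintype ι] [DecidableEq α] {z t : ι → α} {p K : ℝ}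
    {F : (ι → α) → ℝ} (hF : HasQueryMass F K) (hp : 0 ≤ p)
    (h : ∀ a, (count z a : ℝ) - count t a ≤ p * count z a) :
    ∃ σ : Equiv.Perm ι, (F z - F fun i => t (σ i)) ^ 2 ≤ p * K := by
  obtain ⟨ν, hν, hsum, hle⟩ := hF z
  obtain ⟨σ, hσ⟩ := exists_perm_sum_ne_le hν hp h
  exact ⟨σ, (hle _).trans (hσ.trans (by gcongr))⟩

variable [Fintype α]

theorem neg_card_mul_le_of_sum_eq_zero {f : α → ℝ} (hf : ∑ b, f b = 0) {a : α} {C : ℝ}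
    (hC : 0 ≤ C) (h : ∀ b ≠ a, f b ≤ C) : -(Fintype.card α * C) ≤ f a := by
  classical
  have sum_le : ∑ b ∈ Finset.univ.erase a, f b ≤ Fintype.card α * C := by
    refine (Finset.sum_le_card_nsmul _ _ C fun b hb => h b (Finset.ne_of_mem_erase hb)).trans ?_
    rw [nsmul_eq_mul]
    gcongr
    exact Finset.card_le_univ _
  linarith [Finset.add_sum_erase _ f (Finset.mem_univ a)]

theorem exists_card_div_card_le [Fintype ι] [Nonempty α] {c : α → ℝ}
    (hc : ∑ a, c a = Fintype.card ι) :
    ∃ star, (Fintype.card ι : ℝ) / Fintype.card α ≤ c star := by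
  obtain ⟨star, -, h⟩ := Finset.exists_le_of_sum_le (s := Finset.univ)
    (f := fun _ : α => (Fintype.card ι : ℝ) / Fintype.card α) (g := c) Finset.univ_nonempty (by
      rw [hc, Finset.sum_const, Finset.card_univ, nsmul_eq_mul, mul_div_cancel₀]
      exact Nat.cast_ne_zero.2 Fintype.card_ne_zero)
  exact ⟨star, h⟩

variable [DecidableEq α]

/-- The symbols other than `star` that should occur at least `G` times when the type is about
`c`. -/
noncomputable def commonSymbols (c : α → ℝ) (G : ℝ) (star : α) : Finset α :=
  {a | a ≠ star ∧ G ≤ c a}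

/-- The symbols other than `star` that should occur fewer than `G` times when the type is about
`c`. -/
noncomputable def rareSymbols (c : α → ℝ) (G : ℝ) (star : α) : Finset α := {a | a ≠ star ∧ c a < G}

theorem disjoint_rareSymbols_commonSymbols (c : α → ℝ) (G : ℝ) (star : α) :
    Disjoint (rareSymbols c G star) (commonSymbols c G star) := by
  refine Finset.disjoint_filter.2 fun a _ hr hc => hr.2.not_ge hc.2

theorem mem_commonSymbols_or_mem_rareSymbols (c : α → ℝ) (G : ℝ) {star a : α} (ha : a ≠ star) :
    a ∈ commonSymbols c G star ∨ a ∈ rareSymbols c G star := by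
  simp [commonSymbols, rareSymbols, ha, le_or_gt]

variable [Fintype ι] {c : α → ℝ} {G w p : ℝ} {star : α} {z t : ι → α}

theorem count_star_sub_count_star_le (hG : 0 ≤ G) (hw : 0 ≤ w)
    (ht : t ∈ countWindow Finset.univ c w)
    (hz : z ∈ countWindow (commonSymbols c G star) c (2 * w)) :
    (count z star : ℝ) - count t star ≤ Fintype.card α * (G + 3 * w) := by
  have sum_eq : ∑ b, ((count t b : ℝ) - count z b) = 0 := by
    rw [Finset.sum_sub_distrib, sub_eq_zero]
    exact_mod_cast (sum_count t).trans (sum_count z).symm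
  have := neg_card_mul_le_of_sum_eq_zero sum_eq (a := star) (C := G + 3 * w) (by positivity)
    fun b hb => by
      have ht_le := (abs_le.1 (ht b (Finset.mem_univ b))).2
      rcases mem_commonSymbols_or_mem_rareSymbols c G hb with hb | hb
      · linarith [(abs_le.1 (hz b hb)).1]
      · linarith [(Finset.mem_filter.1 hb).2.2, (count z b).cast_nonneg (α := ℝ)]
  linarith

theorem sub_le_count_star (hc : ∑ a, c a = Fintype.card ι) (hw : 0 ≤ w)
    (ht : t ∈ countWindow Finset.univ c w)
    (hz : z ∈ countWindow (commonSymbols c G star) c (2 * w))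
    (hzt : RareLE (rareSymbols c G star) z t) :
    c star - Fintype.card α * (2 * w) ≤ count z star := by
  have sum_eq : ∑ b, ((count z b : ℝ) - c b) = 0 := by
    rw [Finset.sum_sub_distrib, hc, sub_eq_zero]
    exact_mod_cast sum_count z
  have := neg_card_mul_le_of_sum_eq_zero sum_eq (a := star) (C := 2 * w) (by positivity)
    fun b hb => by
      rcases mem_commonSymbols_or_mem_rareSymbols c G hb with hb | hb
      · exact (abs_le.1 (hz b hb)).2
      · have count_le : (count z b : ℝ) ≤ count t b := by exact_mod_cast hzt b hb
        linarith [(abs_le.1 (ht b (Finset.mem_univ b))).2]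
  linarith

theorem count_star_sub_count_star_le_mul (hc : ∑ a, c a = Fintype.card ι)
    (hstar : (Fintype.card ι : ℝ) / Fintype.card α ≤ c star) (hp : 0 < p) (hp_le : p ≤ 1)
    (hw : 0 ≤ w) (hwp : 16 * (Fintype.card α : ℝ) ^ 2 * w ≤ p ^ 2 * Fintype.card ι)
    (ht : t ∈ countWindow Finset.univ c w)
    (hz : z ∈ countWindow (commonSymbols c (5 * w / p) star) c (2 * w))
    (hzt : RareLE (rareSymbols c (5 * w / p) star) z t) :
    (count z star : ℝ) - count t star ≤ p * count z star := by
  have m_pos : (0 : ℝ) < Fintype.card α := Nat.cast_pos.2 (Fintype.card_pos_iff.2 ⟨star⟩)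
  have le_count := sub_le_count_star hc hw ht hz hzt
  have sub_le := count_star_sub_count_star_le (by positivity) hw ht hz
  generalize (Fintype.card α : ℝ) = m at *
  have w_le : w ≤ w / p := le_div_self hw hp hp_le
  have eight_mul_le : m * (8 * (w / p)) ≤ p * (Fintype.card ι / (2 * m)) := by
    rw [← mul_div_assoc p, le_div_iff₀ (by positivity)]
    refine le_of_mul_le_mul_right ?_ hp
    calc m * (8 * (w / p)) * (2 * m) * p = 16 * m ^ 2 * w := by field
      _ ≤ p ^ 2 * Fintype.card ι := hwp
      _ = p * Fintype.card ι * p := by ring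
  have half_le : (Fintype.card ι : ℝ) / (2 * m) ≤ count z star := by
    have two_mul_le : m * (2 * w) ≤ Fintype.card ι / (2 * m) := by
      calc m * (2 * w) ≤ m * (8 * (w / p)) := by gcongr; linarith
        _ ≤ p * (Fintype.card ι / (2 * m)) := eight_mul_le
        _ ≤ Fintype.card ι / (2 * m) := mul_le_of_le_one_left (by positivity) hp_le
    have half_add_half : (Fintype.card ι : ℝ) / m =
        Fintype.card ι / (2 * m) + Fintype.card ι / (2 * m) := by field
    linarith
  calc (count z star : ℝ) - count t star ≤ m * (5 * w / p + 3 * w) := sub_le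
    _ ≤ m * (8 * (w / p)) := by
        gcongr
        linarith [mul_div_assoc 5 w p]
    _ ≤ p * (Fintype.card ι / (2 * m)) := eight_mul_le
    _ ≤ p * count z star := by gcongr

theorem count_sub_count_le_mul (hc : ∑ a, c a = Fintype.card ι)
    (hstar : (Fintype.card ι : ℝ) / Fintype.card α ≤ c star) (hp : 0 < p) (hp_le : p ≤ 1)
    (hw : 0 ≤ w) (hwp : 16 * (Fintype.card α : ℝ) ^ 2 * w ≤ p ^ 2 * Fintype.card ι)
    (ht : t ∈ countWindow Finset.univ c w)
    (hz : z ∈ countWindow (commonSymbols c (5 * w / p) star) c (2 * w))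
    (hzt : RareLE (rareSymbols c (5 * w / p) star) z t) (a : α) :
    (count z a : ℝ) - count t a ≤ p * count z a := by
  rcases eq_or_ne a star with rfl | ha
  · exact count_star_sub_count_star_le_mul hc hstar hp hp_le hw hwp ht hz hzt
  rcases mem_commonSymbols_or_mem_rareSymbols c (5 * w / p) ha with hmem | hmem
  · have le_c : 5 * w ≤ p * c a := (div_le_iff₀' hp).1 (Finset.mem_filter.1 hmem).2.2
    have hta := abs_le.1 (ht a (Finset.mem_univ a))
    have hza := abs_le.1 (hz a hmem)
    nlinarith
  · have count_le : (count z a : ℝ) ≤ count t a := by exact_mod_cast hzt a hmem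
    have : 0 ≤ p * count z a := by positivity
    linarith

/-- The inputs that contain each symbol of `r` at most as often as some input of `X` whose type is
within `w` of `c`. -/
def nearPromise (X : Set (ι → α)) (c : α → ℝ) (w : ℝ) (r : Finset α) : Set (ι → α) :=
  {z | ∃ t ∈ X, t ∈ countWindow Finset.univ c w ∧ RareLE r z t}

theorem decided_of_mem_nearPromise {F : (ι → α) → ℝ} {K : ℝ} (hF : HasQueryMass F K) (hK : 1 ≤ K)
    {X : Set (ι → α)} (hX : ∀ x ∈ X, ∀ σ : Equiv.Perm ι, (fun i => x (σ i)) ∈ X)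
    (hFX : ∀ x ∈ X, F x < 1 / 3 ∨ 2 / 3 < F x) (hc : ∑ a, c a = Fintype.card ι)
    (hstar : (Fintype.card ι : ℝ) / Fintype.card α ≤ c star) (hw : 0 ≤ w) (hpK : p = 1 / (225 * K))
    (hwp : 16 * (Fintype.card α : ℝ) ^ 2 * w ≤ p ^ 2 * Fintype.card ι)
    (hz : z ∈ countWindow (commonSymbols c (5 * w / p) star) c (2 * w))
    (hzX : z ∈ nearPromise X c w (rareSymbols c (5 * w / p) star)) : Decided F z := by
  obtain ⟨t, htX, ht, hzt⟩ := hzX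
  have p_pos : 0 < p := by rw [hpK]; positivity
  have p_le_one : p ≤ 1 := by
    rw [hpK, div_le_one (by positivity)]
    linarith
  obtain ⟨σ, hσ⟩ := hF.exists_perm_sq_sub_le p_pos.le
    (count_sub_count_le_mul hc hstar p_pos p_le_one hw hwp ht hz hzt)
  have p_mul : p * K = (1 / 15) ^ 2 := by
    rw [hpK]
    field_simp
    norm_num
  have := abs_le.1 (abs_le_of_sq_le_sq (hσ.trans_eq p_mul) (by norm_num))
  rcases hFX _ (hX t htX σ) with h | h
  · exact Or.inl (by linarith)
  · exact Or.inr (by linarith)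

end ApproximateType

/-! ### Decision trees and majority votes -/

namespace DecisionTree

variable {n M : ℕ}

/-- Query the indices of a list, overwriting the corresponding entries of `u` by the answers, and
continue with `k`. -/
def queryAll : List (Fin n) → (Fin n → Fin M) → ((Fin n → Fin M) → DecisionTree n M) →
    DecisionTree n M
  | [], u, k => k u
  | i :: l, u, k => query i fun a => queryAll l (Function.update u i a) k

theorem eval_queryAll (l : List (Fin n)) (u : Fin n → Fin M)
    (k : (Fin n → Fin M) → DecisionTree n M) (y : Fin n → Fin M) :
    (queryAll l u k).eval y = (k fun i => if i ∈ l then y i else u i).eval y := by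
  induction l generalizing u with
  | nil => simp [queryAll]
  | cons i l ih =>
    rw [queryAll, eval, ih]
    congr 2
    funext j
    rcases eq_or_ne j i with rfl | hji
    · simp
    · simp [hji]

theorem depth_queryAll_le (l : List (Fin n)) (u : Fin n → Fin M)
    {k : (Fin n → Fin M) → DecisionTree n M} {d : ℕ} (hk : ∀ u, (k u).depth ≤ d) :
    (queryAll l u k).depth ≤ l.length + d := by
  induction l generalizing u with
  | nil => simpa [queryAll] using hk u
  | cons i l ih =>
    have sup_le : (Finset.univ.sup fun a => (queryAll l (Function.update u i a) k).depth) ≤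
        l.length + d := Finset.sup_le fun a _ => ih _
    rw [queryAll, depth, List.length_cons]
    lia

/-- In each of `m` rounds read the indices proposed by `pick` and add its guess, counted as `±1`, to
the score `s`; output the sign of the final score. -/
noncomputable def vote (pick : GuessRule (Fin n) (Fin M) Bool) :
    ℕ → Finset (Fin n) → (Fin n → Fin M) → ℤ → DecisionTree n M
  | 0, _, _, s => leaf (decide (0 < s))
  | m + 1, P, u, s => queryAll (pick P u).1.toList u fun u' =>
      vote pick m (P ∪ (pick P u).1) u' (s + if (pick P u).2 then 1 else -1)

variable {pick : GuessRule (Fin n) (Fin M) Bool}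

theorem depth_vote_le {C : ℕ} (hpick : ∀ P u, (pick P u).1.card ≤ C) (m : ℕ) (P : Finset (Fin n))
    (u : Fin n → Fin M) (s : ℤ) : (vote pick m P u s).depth ≤ m * C := by
  induction m generalizing P u s with
  | zero => simp [vote, depth]
  | succ m ih =>
    calc (vote pick (m + 1) P u s).depth
        ≤ (pick P u).1.toList.length + m * C := depth_queryAll_le _ _ fun u' => ih _ u' _
      _ ≤ C + m * C := by simpa using hpick P u
      _ = (m + 1) * C := by ring

/-- Every wrong guess costs one unread element of `S`, and every right guess moves the score
towards `v`. -/
theorem eval_vote {y : Fin n → Fin M} {v : Bool} {S : Finset (Fin n)}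
    (hS : pick.WrongGuessHits y v S) (m : ℕ) (P : Finset (Fin n)) (u : Fin n → Fin M) (s : ℤ)
    (hu : ∀ i ∈ P, u i = y i) (hs : 1 + 2 * ((S \ P).card : ℤ) ≤ (if v then s else -s) + m) :
    (vote pick m P u s).eval y = v := by
  induction m generalizing P u s with
  | zero =>
    rw [vote, eval]
    cases v <;> simp only [if_true, Bool.false_eq_true, if_false, decide_eq_true_eq,
      decide_eq_false_iff_not] at hs ⊢ <;> lia
  | succ m ih =>
    rw [vote, eval_queryAll]
    refine ih _ _ _ (fun i hi => ?_) ?_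
    · by_cases hpi : i ∈ (pick P u).1
      · simp [hpi]
      · simpa [hpi] using hu i (by simpa [hpi] using hi)
    · have sdiff_subset : S \ (P ∪ (pick P u).1) ⊆ S \ P :=
        Finset.sdiff_subset_sdiff subset_rfl Finset.subset_union_left
      have card_le := Finset.card_le_card sdiff_subset
      push_cast at hs
      by_cases hguess : (pick P u).2 = v
      · rw [hguess]
        cases v <;> simp only [if_true, Bool.false_eq_true, if_false] at hs ⊢ <;> lia
      · obtain ⟨i, hi, hiS, hiP⟩ := hS P u hu hguess
        have card_lt : (S \ (P ∪ (pick P u).1)).card < (S \ P).card :=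
          Finset.card_lt_card ((Finset.ssubset_iff_of_subset sdiff_subset).2
            ⟨i, by simp [hiS, hiP], by simp [hi]⟩)
        rw [Bool.eq_not.2 hguess]
        cases v <;> simp only [if_true, Bool.false_eq_true, if_false, Bool.not_true,
          Bool.not_false] at hs ⊢ <;> lia

end DecisionTree

variable {n M q : ℕ} {X : Set (Fin n → Fin M)} {f : X → Bool}

theorem randomizedComputable_of_family {Ω : Type} [Fintype Ω] [Nonempty Ω]
    (T : Ω → DecisionTree n M) (hT : ∀ ω, (T ω).depth ≤ q)
    (h : ∀ x : X, 3 * Finset.card {ω | (T ω).eval x.1 ≠ f x} < Fintype.card Ω) :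
    RandomizedComputable f q := by
  refine ⟨(PMF.uniformOfFintype Ω).map T, fun t ht => ?_, fun x => ?_⟩
  · obtain ⟨ω, _, rfl⟩ := (PMF.mem_support_map_iff _ _ _).1 ht
    exact hT ω
  have prob_eq : ((PMF.uniformOfFintype Ω).map fun ω => (T ω).eval x.1) (!f x) =
      Finset.card {ω | (T ω).eval x.1 ≠ f x} / Fintype.card Ω := by
    rw [PMF.map_apply, tsum_fintype, div_eq_mul_inv, ← nsmul_eq_mul, ← Finset.sum_const,
      Finset.sum_filter]
    refine Finset.sum_congr rfl fun ω _ => ?_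
    simp only [PMF.uniformOfFintype_apply, ne_eq, ← Bool.eq_not, eq_comm (a := !f x)]
  have card_ne_zero : (Fintype.card Ω : ENNReal) ≠ 0 := by simp
  rw [PMF.map_comp, Function.comp_def, prob_eq,
    ENNReal.div_lt_iff (Or.inl card_ne_zero) (Or.inl (by simp)), mul_comm, ← div_eq_mul_one_div,
    ENNReal.lt_div_iff_mul_lt (Or.inl (by simp)) (Or.inl (by simp)), mul_comm]
  exact_mod_cast h x

theorem randomizedComputable_of_tree (T : DecisionTree n M) (hT : T.depth ≤ q)
    (h : ∀ x : X, T.eval x.1 = f x) : RandomizedComputable f q :=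
  randomizedComputable_of_family (Ω := Unit) (fun _ => T) (fun _ => hT) fun x => by simp [h x]

theorem randomizedComputable_self [NeZero M] (f : X → Bool) : RandomizedComputable f n := by
  classical
  refine randomizedComputable_of_tree (DecisionTree.queryAll (List.finRange n) 0
    fun u => .leaf (if h : u ∈ X then f ⟨u, h⟩ else false)) ?_ fun x => ?_
  · simpa using DecisionTree.depth_queryAll_le (List.finRange n) 0 (d := 0) fun u => le_rfl
  · simp [DecisionTree.eval_queryAll, DecisionTree.eval]

/-! ### Estimating the type by sampling -/

section Sampling

variable {ι α : Type*} [Fintype ι]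

theorem card_mul_sum_sq_sum_sample {g : ι → ℝ} (hg : ∑ i, g i = 0) (s : ℕ) :
    Fintype.card ι * ∑ ω : Fin s → ι, (∑ j, g (ω j)) ^ 2 =
      s * (Fintype.card ι : ℝ) ^ s * ∑ i, g i ^ 2 := by
  classical
  induction s with
  | zero => simp
  | succ s ih =>
    have sum_sq_eq : ∑ ω : Fin (s + 1) → ι, (∑ j, g (ω j)) ^ 2 =
        (Fintype.card ι : ℝ) ^ s * ∑ i, g i ^ 2 +
          Fintype.card ι * ∑ ω : Fin s → ι, (∑ j, g (ω j)) ^ 2 := by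
      rw [← (Fin.consEquiv fun _ : Fin (s + 1) => ι).sum_comp, Fintype.sum_prod_type]
      have sq_eq (i : ι) (ω : Fin s → ι) :
          (∑ j, g ((Fin.consEquiv fun _ : Fin (s + 1) => ι) (i, ω) j)) ^ 2 =
            g i ^ 2 + 2 * (g i * ∑ j, g (ω j)) + (∑ j, g (ω j)) ^ 2 := by
        rw [Fin.sum_univ_succ]
        simp only [Fin.consEquiv_apply, Fin.cons_zero, Fin.cons_succ]
        ring
      simp only [sq_eq, Finset.sum_add_distrib, ← Finset.mul_sum, ← Finset.sum_mul, hg, zero_mul,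
        mul_zero, add_zero, Finset.sum_const, Finset.card_univ, nsmul_eq_mul, Fintype.card_pi,
        Finset.prod_const, Fintype.card_fin, Nat.cast_pow]
    rw [sum_sq_eq, mul_add, ih]
    push_cast
    ring

theorem card_lt_abs_sum_sample_mul_le [Nonempty ι] {g : ι → ℝ} (hg : ∑ i, g i = 0)
    (hg_le : ∀ i, |g i| ≤ 1) (s : ℕ) {δ : ℝ} (hδ : 0 ≤ δ) :
    Finset.card {ω : Fin s → ι | δ * s < |∑ j, g (ω j)|} * (s * δ ^ 2) ≤
      (Fintype.card ι : ℝ) ^ s := by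
  rcases Nat.eq_zero_or_pos s with rfl | hs
  · simp
  have card_pos : (0 : ℝ) < Fintype.card ι := Nat.cast_pos.2 Fintype.card_pos
  have s_pos : (0 : ℝ) < s := Nat.cast_pos.2 hs
  have sum_sq_le : ∑ i, g i ^ 2 ≤ Fintype.card ι := by
    simpa using Finset.sum_le_card_nsmul Finset.univ (fun i => g i ^ 2) 1 fun i _ =>
      (sq_le_one_iff_abs_le_one _).2 (hg_le i)
  refine le_of_mul_le_mul_left ?_ (mul_pos card_pos s_pos)
  calc Fintype.card ι * s *
        (Finset.card {ω : Fin s → ι | δ * s < |∑ j, g (ω j)|} * (s * δ ^ 2))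
      = Fintype.card ι * ∑ ω : Fin s → ι with δ * s < |∑ j, g (ω j)|, (δ * s) ^ 2 := by
        rw [Finset.sum_const, nsmul_eq_mul]
        ring
    _ ≤ Fintype.card ι * ∑ ω : Fin s → ι with δ * s < |∑ j, g (ω j)|, (∑ j, g (ω j)) ^ 2 := by
        refine mul_le_mul_of_nonneg_left (Finset.sum_le_sum fun ω hω => ?_) card_pos.le
        exact (pow_le_pow_left₀ (by positivity) (Finset.mem_filter.1 hω).2.le 2).trans_eq
          (sq_abs _)
    _ ≤ Fintype.card ι * ∑ ω : Fin s → ι, (∑ j, g (ω j)) ^ 2 := by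
        gcongr
        exact Finset.filter_subset _ _
    _ = s * (Fintype.card ι : ℝ) ^ s * ∑ i, g i ^ 2 := card_mul_sum_sq_sum_sample hg s
    _ ≤ s * (Fintype.card ι : ℝ) ^ s * Fintype.card ι := by gcongr
    _ = Fintype.card ι * s * (Fintype.card ι : ℝ) ^ s := by ring

variable [DecidableEq α]

/-- The estimate for the type of `y` obtained from the entries of `y` at the sampled indices `ω`. -/
noncomputable def estimate {s : ℕ} (y : ι → α) (ω : Fin s → ι) (a : α) : ℝ :=
  Fintype.card ι / s * count (y ∘ ω) a

theorem sum_estimate [Fintype α] {s : ℕ} (hs : s ≠ 0) (y : ι → α) (ω : Fin s → ι) :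
    ∑ a, estimate y ω a = Fintype.card ι := by
  have sum_eq : ∑ a, (count (y ∘ ω) a : ℝ) = s := by
    exact_mod_cast (sum_count (y ∘ ω)).trans (Fintype.card_fin s)
  simp only [estimate, ← Finset.mul_sum, sum_eq]
  exact div_mul_cancel₀ _ (Nat.cast_ne_zero.2 hs)

theorem sum_ite_eq_count (z : ι → α) (a : α) :
    ∑ i, (if z i = a then 1 else 0 : ℝ) = count z a := by
  simp [count]

theorem card_estimate_error_mul_le [Nonempty ι] (y : ι → α) (a : α) {s : ℕ} (hs : s ≠ 0) {δ : ℝ}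
    (hδ : 0 ≤ δ) :
    Finset.card {ω : Fin s → ι | δ * Fintype.card ι < |(count y a : ℝ) - estimate y ω a|} *
      (s * δ ^ 2) ≤ (Fintype.card ι : ℝ) ^ s := by
  have card_pos : (0 : ℝ) < Fintype.card ι := Nat.cast_pos.2 Fintype.card_pos
  have s_pos : (0 : ℝ) < s := Nat.cast_pos.2 hs.bot_lt
  have count_div_le : (count y a : ℝ) / Fintype.card ι ≤ 1 := by
    rw [div_le_one card_pos]
    exact_mod_cast Finset.card_le_univ _
  have count_div_nonneg : 0 ≤ (count y a : ℝ) / Fintype.card ι := by positivity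
  let g (i : ι) : ℝ := (if y i = a then 1 else 0) - count y a / Fintype.card ι
  have sum_g : ∑ i, g i = 0 := by
    simp only [g, Finset.sum_sub_distrib, sum_ite_eq_count, Finset.sum_const, Finset.card_univ,
      nsmul_eq_mul]
    field
  have abs_g_le (i) : |g i| ≤ 1 := by
    simp only [g]
    split_ifs <;> exact abs_le.2 ⟨by linarith, by linarith⟩
  have sum_g_sample (ω : Fin s → ι) :
      ∑ j, g (ω j) = s / Fintype.card ι * (estimate y ω a - count y a) := by
    have := sum_ite_eq_count (y ∘ ω) a
    simp only [Function.comp_apply] at this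
    simp only [g, Finset.sum_sub_distrib, this, Finset.sum_const, Finset.card_univ,
      Fintype.card_fin, nsmul_eq_mul, estimate]
    field
  refine le_trans ?_ (card_lt_abs_sum_sample_mul_le sum_g abs_g_le s hδ)
  refine mul_le_mul_of_nonneg_right (Nat.cast_le.2 (Finset.card_le_card
    (Finset.monotone_filter_right _ fun ω _ hω => ?_))) (by positivity)
  rw [sum_g_sample, abs_mul, abs_of_pos (div_pos s_pos card_pos), abs_sub_comm]
  calc δ * s = s / Fintype.card ι * (δ * Fintype.card ι) := by field
    _ < _ := by gcongr

open Classical in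
theorem three_mul_card_notMem_countWindow_estimate_lt [Nonempty ι] [Fintype α] (y : ι → α) {s : ℕ}
    {δ : ℝ} (hδ : 0 ≤ δ) (hs : 3 * Fintype.card α < s * δ ^ 2) :
    3 * Finset.card {ω : Fin s → ι |
      y ∉ countWindow Finset.univ (estimate y ω) (δ * Fintype.card ι)} < Fintype.card ι ^ s := by
  have sδ_pos : 0 < s * δ ^ 2 := lt_of_le_of_lt (by positivity) hs
  have s_ne_zero : s ≠ 0 := by
    rintro rfl
    simp at sδ_pos
  let bad (a : α) : Finset (Fin s → ι) :=
    {ω | δ * Fintype.card ι < |(count y a : ℝ) - estimate y ω a|}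
  have card_le : (Finset.card {ω : Fin s → ι |
      y ∉ countWindow Finset.univ (estimate y ω) (δ * Fintype.card ι)} : ℝ) ≤
        ∑ a, ((bad a).card : ℝ) := by
    have filter_subset : ({ω : Fin s → ι |
        y ∉ countWindow Finset.univ (estimate y ω) (δ * Fintype.card ι)} : Finset _) ⊆
          Finset.univ.biUnion bad := fun ω hω => by
      simpa [bad, countWindow] using hω
    exact_mod_cast (Finset.card_le_card filter_subset).trans Finset.card_biUnion_le
  have card_mul_le : (∑ a, ((bad a).card : ℝ)) * (s * δ ^ 2) ≤
      Fintype.card α * (Fintype.card ι : ℝ) ^ s := by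
    rw [Finset.sum_mul]
    simpa using Finset.sum_le_card_nsmul Finset.univ _ _ fun a _ =>
      card_estimate_error_mul_le y a s_ne_zero hδ
  have card_pow_pos : 0 < (Fintype.card ι : ℝ) ^ s := pow_pos (Nat.cast_pos.2 Fintype.card_pos) s
  have : 3 * (∑ a, ((bad a).card : ℝ)) < (Fintype.card ι : ℝ) ^ s := by
    refine lt_of_mul_lt_mul_right ?_ sδ_pos.le
    calc 3 * (∑ a, ((bad a).card : ℝ)) * (s * δ ^ 2)
        ≤ 3 * (Fintype.card α * (Fintype.card ι : ℝ) ^ s) := by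
          rw [mul_assoc]
          gcongr
      _ < (Fintype.card ι : ℝ) ^ s * (s * δ ^ 2) := by
          rw [← mul_assoc, mul_comm]
          exact mul_lt_mul_of_pos_left hs card_pow_pos
  exact_mod_cast (mul_le_mul_of_nonneg_left card_le (by norm_num)).trans_lt this

end Sampling

/-! ### From a function of bounded query mass to a randomized algorithm -/

variable {n M : ℕ} {X : Set (Fin n → Fin M)} {f : X → Bool} {F : (Fin n → Fin M) → ℝ}

/-- The function `F` is below `1/3` where `f` is `false` and above `2/3` where `f` is `true`. -/
def Separates (F : (Fin n → Fin M) → ℝ) (f : X → Bool) : Prop :=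
  ∀ x : X, F x.1 < 1 / 3 ∧ f x = false ∨ 2 / 3 < F x.1 ∧ f x = true

theorem Separates.side_eq (h : Separates F f) (x : X) : side F x.1 = f x := by
  rcases h x with ⟨hF, hf⟩ | ⟨hF, hf⟩
  · rw [hf, side, decide_eq_false_iff_not]
    linarith
  · rw [hf, side, decide_eq_true_eq]
    linarith

theorem Separates.eq_of_eq (h : Separates F f) {x y : X} (hxy : F x.1 = F y.1) : f x = f y := by
  rw [← h.side_eq, ← h.side_eq, side, side, hxy]

variable [NeZero M]

theorem exists_decisionTree_of_mem_countWindow {K C : ℕ} (hF : HasQueryMass F K) (hK : 0 < K)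
    (hX : IsSymmetric X) (hf : Separates F f) {c : Fin M → ℝ} (hc : ∑ a, c a = n) {w p : ℝ}
    (hC : C = 25 * K * (25 * K)) (hCw : (C : ℝ) + 2 ≤ w) (hpK : p = 1 / (225 * K))
    (hwp : 16 * (M : ℝ) ^ 2 * w ≤ p ^ 2 * n) :
    ∃ T : DecisionTree n M, T.depth ≤ (2 * C + 1) * C ∧
      ∀ x : X, x.1 ∈ countWindow Finset.univ c w → T.eval x.1 = f x := by
  subst hC
  have hc_card : ∑ a, c a = Fintype.card (Fin n) := by simpa using hc
  obtain ⟨star, hstar⟩ := exists_card_div_card_le hc_card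
  have hw : 0 ≤ w := by linarith [(25 * K * (25 * K)).cast_nonneg (α := ℝ)]
  let A := commonSymbols c (5 * w / p) star
  let r := rareSymbols c (5 * w / p) star
  have decided : ∀ z ∈ countWindow A c (2 * w) ∩ nearPromise X c w r, Decided F z := fun z hz =>
    decided_of_mem_nearPromise hF (by exact_mod_cast hK) hX
      (fun x hx => (hf ⟨x, hx⟩).imp And.left And.left) hc_card hstar hw hpK (by simpa using hwp)
      hz.1 hz.2
  obtain ⟨pick, card_le, hits⟩ := exists_guessRule
    (A := A) (r := r) (N := nearPromise X c w r)
    (fun y ⟨t, ht, htw, hyt⟩ z hzy => ⟨t, ht, htw, hzy.trans hyt⟩)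
    (disjoint_rareSymbols_commonSymbols c (5 * w / p) star) (star := star)
    (by simp [A, commonSymbols]) (by simp [r, rareSymbols]) hCw (hF.blockSensitivityLE decided)
  refine ⟨DecisionTree.vote pick (2 * (25 * K * (25 * K)) + 1) ∅ 0 0,
    DecisionTree.depth_vote_le card_le _ _ _ _, fun x hx => ?_⟩
  obtain ⟨S, hS, hSpick⟩ := hits x.1 ⟨x.1, x.2, hx, fun _ _ => le_rfl⟩
    fun a _ => hx a (Finset.mem_univ a)
  rw [← hf.side_eq x]
  refine DecisionTree.eval_vote hSpick _ _ _ _ (by simp) ?_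
  simp only [Finset.sdiff_empty, neg_zero, ite_self]
  lia

theorem randomizedComputable_of_forall_countWindow {d s : ℕ} {δ : ℝ} (hδ : 0 ≤ δ)
    (hs : 3 * M < s * δ ^ 2) (hn : n ≠ 0)
    (h : ∀ c : Fin M → ℝ, ∑ a, c a = n → ∃ T : DecisionTree n M, T.depth ≤ d ∧
      ∀ x : X, x.1 ∈ countWindow Finset.univ c (δ * n) → T.eval x.1 = f x) :
    RandomizedComputable f (s + d) := by
  have : NeZero n := ⟨hn⟩
  have s_ne_zero : s ≠ 0 := by
    rintro rfl
    have : (0 : ℝ) ≤ 3 * M := by positivity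
    simp only [Nat.cast_zero, zero_mul] at hs
    linarith
  have sum_estimate_eq (y : Fin n → Fin M) (ω : Fin s → Fin n) : ∑ a, estimate y ω a = n := by
    simpa using sum_estimate s_ne_zero y ω
  choose T depth_le eval_eq using fun (y : Fin n → Fin M) (ω : Fin s → Fin n) =>
    h (estimate y ω) (sum_estimate_eq y ω)
  let T' (ω : Fin s → Fin n) : DecisionTree n M :=
    DecisionTree.queryAll (List.ofFn ω) 0 fun u => T u ω
  have eval_eq_of_mem (x : X) (ω) (hω : x.1 ∈ countWindow Finset.univ (estimate x.1 ω) (δ * n)) :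
      (T' ω).eval x.1 = f x := by
    let u (i : Fin n) : Fin M := if i ∈ List.ofFn ω then x.1 i else 0
    have u_comp : u ∘ ω = x.1 ∘ ω := by
      funext j
      simp [u]
    have estimate_eq : estimate u ω = estimate x.1 ω := by
      funext a
      rw [estimate, estimate, u_comp]
    rw [DecisionTree.eval_queryAll]
    exact eval_eq u ω x (estimate_eq ▸ hω)
  refine randomizedComputable_of_family T' (fun ω => ?_) fun x => ?_
  · simpa using DecisionTree.depth_queryAll_le (List.ofFn ω) 0 fun u => depth_le u ω
  · classical
    rw [Fintype.card_fun, Fintype.card_fin s]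
    refine lt_of_le_of_lt (Nat.mul_le_mul_left 3 (Finset.card_le_card
      (Finset.monotone_filter_right _ fun ω _ => mt fun hω => eval_eq_of_mem x ω ?_)))
      (three_mul_card_notMem_countWindow_estimate_lt x.1 hδ (by simpa using hs))
    simpa using hω

theorem randomizedComputable_of_hasQueryMass {K C E : ℕ} (hF : HasQueryMass F K) (hK : 0 < K)
    (hX : IsSymmetric X) (hf : Separates F f) (hC : C = 25 * K * (25 * K))
    (hE : E = 810000 * M ^ 2 * K ^ 2) (hn : E * (C + 2) ≤ n) :
    RandomizedComputable f (3 * M * E ^ 2 + 1 + (2 * C + 1) * C) := by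
  have E_pos : 0 < E := by
    have := NeZero.pos M
    rw [hE]
    positivity
  have E_pos' : (0 : ℝ) < E := Nat.cast_pos.2 E_pos
  refine randomizedComputable_of_forall_countWindow (δ := 1 / E) (by positivity) ?_
    (by have := Nat.mul_pos E_pos (Nat.succ_pos (C + 1)); lia) fun c hc =>
    exists_decisionTree_of_mem_countWindow hF hK hX hf hc hC ?_ rfl ?_
  · push_cast
    field_simp
    linarith
  · rw [one_div_mul_eq_div, le_div_iff₀' E_pos']
    exact_mod_cast hn
  · refine le_of_eq ?_
    have : (M : ℝ) ≠ 0 := Nat.cast_ne_zero.2 (NeZero.ne M)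
    rw [hE]
    push_cast
    field

theorem R_le_mul_of_hasQueryMass {K : ℕ} (hF : HasQueryMass F K) (hX : IsSymmetric X)
    (hf : Separates F f) : R f ≤ 10 ^ 13 * (M ^ 5 * K ^ 4) := by
  rcases Nat.eq_zero_or_pos K with rfl | hK
  · have const (x y : X) : f x = f y := hf.eq_of_eq (hF.eq_of_nonpos (by simp) x.1 y.1)
    have : RandomizedComputable f 0 := by
      rcases isEmpty_or_nonempty X with hempty | ⟨⟨x₀⟩⟩
      · exact randomizedComputable_of_tree (.leaf true) le_rfl fun x => hempty.elim x
      · exact randomizedComputable_of_tree (.leaf (f x₀)) le_rfl (const x₀)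
    exact (Nat.sInf_le this).trans (Nat.zero_le _)
  have M_pos := NeZero.pos M
  have pow_K : K ^ 2 ≤ K ^ 4 := Nat.pow_le_pow_right hK (by norm_num)
  have pow_M : M ^ 2 ≤ M ^ 5 := Nat.pow_le_pow_right M_pos (by norm_num)
  have one_le_M : 1 ≤ M ^ 5 := Nat.one_le_pow _ _ M_pos
  have one_le_K : 1 ≤ K ^ 4 := Nat.one_le_pow _ _ hK
  rcases le_or_gt (810000 * M ^ 2 * K ^ 2 * (25 * K * (25 * K) + 2)) n with hn | hn
  · calc R f ≤ _ := Nat.sInf_le (randomizedComputable_of_hasQueryMass hF hK hX hf rfl rfl hn)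
      _ = 1968300000000 * (M ^ 5 * K ^ 4) + 781250 * (1 * K ^ 4) + 625 * (1 * K ^ 2) + 1 * 1 := by
        ring
      _ ≤ 1968300000000 * (M ^ 5 * K ^ 4) + 781250 * (M ^ 5 * K ^ 4) + 625 * (M ^ 5 * K ^ 4) +
          M ^ 5 * K ^ 4 := by gcongr
      _ = 1968300781876 * (M ^ 5 * K ^ 4) := by ring
      _ ≤ 10 ^ 13 * (M ^ 5 * K ^ 4) := by gcongr; norm_num
  · calc R f ≤ n := Nat.sInf_le (randomizedComputable_self f)
      _ ≤ 506250000 * (M ^ 2 * K ^ 4) + 1620000 * (M ^ 2 * K ^ 2) := hn.le.trans_eq (by ring)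
      _ ≤ 506250000 * (M ^ 5 * K ^ 4) + 1620000 * (M ^ 5 * K ^ 4) := by gcongr
      _ = 507870000 * (M ^ 5 * K ^ 4) := by ring
      _ ≤ 10 ^ 13 * (M ^ 5 * K ^ 4) := by gcongr; norm_num

theorem R_le_mul_Q_pow_eight (hX : IsSymmetric X) (f : X → Bool) :
    R f ≤ 10 ^ 18 * M ^ 5 * Q f ^ 8 := by
  obtain ⟨A, hA⟩ : QuantumComputable f (Q f) :=
    Nat.sInf_mem (s := {q | QuantumComputable f q}) ⟨n, quantumComputable_self f⟩
  have mass : HasQueryMass (fun x => A.prob (Q f) x true) ((16 * Q f ^ 2 : ℕ) : ℝ) := by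
    exact_mod_cast A.hasQueryMass (Q f) true
  have separates : Separates (fun x => A.prob (Q f) x true) f := fun x => by
    have error_lt := hA x
    cases hfx : f x <;> rw [hfx] at error_lt
    · exact Or.inl ⟨error_lt, rfl⟩
    · refine Or.inr ⟨?_, rfl⟩
      have prob_add : A.prob (Q f) x.1 true + A.prob (Q f) x.1 false = 1 :=
        A.prob_add_prob_not x.1 (Q f) true
      rw [Bool.not_true] at error_lt
      linarith
  calc R f ≤ 10 ^ 13 * (M ^ 5 * (16 * Q f ^ 2) ^ 4) := R_le_mul_of_hasQueryMass mass hX separates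
    _ = 655360000000000000 * (M ^ 5 * Q f ^ 8) := by ring
    _ ≤ 10 ^ 18 * (M ^ 5 * Q f ^ 8) := by gcongr; norm_num
    _ = 10 ^ 18 * M ^ 5 * Q f ^ 8 := by ring

theorem inv_mul_rpow_le_of_le_mul_pow {a b B k : ℕ} (h : a ≤ B * b ^ k) (hk : k ≠ 0) {p : ℝ}
    (hp : 0 < p) (hkp : k * p ≤ 1) : (B : ℝ)⁻¹ * (a : ℝ) ^ p ≤ b := by
  rcases Nat.eq_zero_or_pos a with rfl | ha
  · simp [hp.ne']
  have hBb : 0 < B * b ^ k := ha.trans_le h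
  have B_pos : 0 < B := Nat.pos_of_mul_pos_right hBb
  have b_pos : 0 < b := Nat.pos_of_ne_zero fun hb => by simp [hb, hk] at hBb
  have one_le_B : (1 : ℝ) ≤ B := by exact_mod_cast B_pos
  have one_le_b : (1 : ℝ) ≤ b := by exact_mod_cast b_pos
  have p_le_one : p ≤ 1 := by
    have : (1 : ℝ) ≤ k := by exact_mod_cast Nat.one_le_iff_ne_zero.2 hk
    nlinarith
  rw [inv_mul_le_iff₀ (by positivity)]
  calc (a : ℝ) ^ p ≤ (B * b ^ k : ℝ) ^ p := by
        gcongr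
        exact_mod_cast h
    _ = (B : ℝ) ^ p * (b : ℝ) ^ (k * p) := by
        rw [Real.mul_rpow (by positivity) (by positivity), ← Real.rpow_natCast_mul (by positivity)]
    _ ≤ (B : ℝ) ^ (1 : ℝ) * (b : ℝ) ^ (1 : ℝ) := by gcongr
    _ = B * b := by rw [Real.rpow_one, Real.rpow_one]

end QueryComplexity

open QueryComplexity in
theorem mainTheorem2_general {n M : ℕ} [NeZero M] {X : Set (Fin n → Fin M)} (hX : IsSymmetric X)
    (f : X → Bool) {p : ℝ} (hp : 0 < p) (hp_le : p ≤ 1 / 8) :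
    ((10 ^ 18 * M ^ 5 : ℕ) : ℝ)⁻¹ * (R f : ℝ) ^ p ≤ Q f :=
  inv_mul_rpow_le_of_le_mul_pow (R_le_mul_Q_pow_eight hX f) (by norm_num) hp
    (by push_cast; linarith)

theorem mainTheorem2 :
    (∀ M : ℕ, 2 ≤ M → ∃ c : ℝ, 0 < c ∧
      ∀ (n : ℕ) (X : Set (Fin n → Fin M)), QueryComplexity.IsSymmetric X → ∀ f : X → Bool,
        c * (QueryComplexity.R f : ℝ) ^ (1 / (12 * ((M : ℝ) - 1))) ≤ (QueryComplexity.Q f : ℝ)) ∧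
    (∃ c : ℝ, 0 < c ∧
      ∀ (n : ℕ) (X : Set (Fin n → Fin 2)), QueryComplexity.IsSymmetric X → ∀ f : X → Bool,
        c * (QueryComplexity.R f : ℝ) ^ (1 / 12 : ℝ) ≤ (QueryComplexity.Q f : ℝ)) := by
  refine ⟨fun M hM => ?_, _, by positivity, fun n X hX f =>
    mainTheorem2_general hX f (by norm_num) (by norm_num)⟩
  have : NeZero M := ⟨by lia⟩
  have one_le : (1 : ℝ) ≤ M - 1 := by
    have : (2 : ℝ) ≤ M := by exact_mod_cast hM
    linarith
  refine ⟨_, inv_pos.2 (Nat.cast_pos.2 (Nat.pos_of_neZero (10 ^ 18 * M ^ 5))), fun n X hX f =>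
    mainTheorem2_general hX f (by positivity) ?_⟩
  gcongr
  linarith
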